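/- Let $B_n$ be the hyperoctahedral group, i.e. the set of signed permutations $\pi=\pi_1\cdots\pi_n$ (words in which each of $1,\dots,n$ appears exactly once, possibly negated; a bar denotes negation), and let $SI_n\subseteq B_n$ be the set of those with $\pi\circ\pi=\mathrm{id}$, where $\pi$ is viewed as the map $\pm i\mapsto\pm\pi_i$ of $\{\pm1,\dots,\pm n\}$. A signed permutation $\pi\in B_n$ contains the pattern $\tau\in B_k$ if there are $1\le i_1<\dots<i_k\le n$ such that, for all $a,b$, $|\pi_{i_a}|<|\pi_{i_b}|$ if and only if $|\tau_a|<|\tau_b|$, and $\pi_{i_a}>0$ if and only if $\tau_a>0$; otherwise $\pi$ avoids $\tau$. Write $\sigma\sim\tau$ (respectively $\sigma\stackrel{I}{\sim}\tau$) if, for every $n\ge1$, the patterns $\sigma$ and $\tau$ are avoided by the same number of elements of $B_n$ (respectively of $SI_n$). (1) The $48$ patterns in $B_3$ form exactly $2$ classes under $\sim$, and every pattern is equivalent to exactly one of $123$ and $1\bar32$. The class of $1\bar32$ consists of the $16$ patterns $$13\bar2,\ 1\bar32,\ \bar13\bar2,\ \bar1\bar32,\ 2\bar13,\ 2\bar1\bar3,\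 \bar213,\ \bar21\bar3,\ 2\bar31,\ 2\bar3\bar1,\ \bar231,\ \bar23\bar1,\ 31\bar2,\ 3\bar12,\ \bar31\bar2,\ \bar3\bar12,$$ and the other $32$ patterns form the class of $123$. (2) The patterns in $B_3$ form exactly $6$ classes under $\stackrel{I}{\sim}$, and every pattern is equivalent to exactly one of $123$, $1\bar32$, $231$, $\bar231$, $23\bar1$, $\bar321$. The classes are: the class of $1\bar32$: $13\bar2,\ 1\bar32,\ \bar13\bar2,\ \bar1\bar32,\ 2\bar13,\ 2\bar1\bar3,\ \bar213,\ \bar21\bar3$; the class of $231$: $231,\ 312,\ \bar2\bar3\bar1,\ \bar3\bar1\bar2$; the class of $\bar231$: $2\bar31,\ 2\bar3\bar1,\ \bar231,\ \bar23\bar1,\ 31\bar2,\ 3\bar12,\ \bar31\bar2,\ \bar3\bar12$; the class of $23\bar1$: $23\bar1,\ \bar2\bar31,\ 3\bar1\bar2,\ \bar312$; the class of $\bar321$: $32\bar1,\ 3\bar2\bar1,\ \bar321,\ \bar3\bar21$; and the class of $123$, consisting of the remaining $20$ patterns. -/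

import Mathlib

/-- A signed permutation of `[n]`, written as a word `w₁ w₂ … wₙ` of integers in which each of
`1, …, n` appears (hence exactly once) up to sign; a barred letter is a negative one.
Positions are indexed from `0`. -/
@[ext]
structure SignedPerm (n : ℕ) where
  word : Fin n → ℤ
  appears : ∀ j : Fin n, ∃ i : Fin n, (word i).natAbs = j + 1

namespace SignedPerm

/-- The absolute values of the letters are exactly `1, …, n`. -/
theorem natAbs_mem {n : ℕ} (π : SignedPerm n) (i : Fin n) :
    1 ≤ (π.word i).natAbs ∧ (π.word i).natAbs ≤ n := by
  choose f hf using π.appears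
  have hinj : Function.Injective f := by
    intro a b hab
    have h := hf a
    rw [hab, hf b] at h
    exact Fin.ext (by omega)
  obtain ⟨j, rfl⟩ := Finite.surjective_of_injective hinj i
  rw [hf j]
  have := j.isLt
  omega

instance instFinite (n : ℕ) : Finite (SignedPerm n) := by
  have hfin : Finite (Fin n → Set.Icc (-(n : ℤ)) (n : ℤ)) := inferInstance
  refine Finite.of_injective
    (fun (π : SignedPerm n) (i : Fin n) =>
      (⟨π.word i, by
        have := π.natAbs_mem i
        constructor <;> omega⟩ : Set.Icc (-(n : ℤ)) (n : ℤ))) ?_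
  intro π ρ h
  ext i
  exact congrArg Subtype.val (congrFun h i)

/-- `π` contains the pattern `τ`. -/
def Contains {n k : ℕ} (π : SignedPerm n) (τ : SignedPerm k) : Prop :=
  ∃ ι : Fin k → Fin n, StrictMono ι ∧ ∀ a b : Fin k,
    ((π.word (ι a)).natAbs < (π.word (ι b)).natAbs ↔ (τ.word a).natAbs < (τ.word b).natAbs) ∧
    (0 < π.word (ι a) ↔ 0 < τ.word a)

/-- `π` as the odd map of `{±1, …, ±n}`, `i ↦ πᵢ`, `-i ↦ -πᵢ`, extended by the identity to the
remaining integers. -/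
def act {n : ℕ} (π : SignedPerm n) (z : ℤ) : ℤ :=
  if h : 1 ≤ z.natAbs ∧ z.natAbs ≤ n then
    z.sign * π.word ⟨z.natAbs - 1, by omega⟩
  else z

/-- `π` is an involution in the hyperoctahedral group: `π ∘ π = id` (the identity included). -/
def IsInvolution {n : ℕ} (π : SignedPerm n) : Prop :=
  Function.Involutive π.act

/-- The number of `τ`-avoiding elements of the hyperoctahedral group of rank `n`. -/
noncomputable def numAvoiders {k : ℕ} (τ : SignedPerm k) (n : ℕ) : ℕ :=
  Nat.card {π : SignedPerm n // ¬ π.Contains τ}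

/-- The number of `τ`-avoiding involutions in the hyperoctahedral group of rank `n`. -/
noncomputable def numInvAvoiders {k : ℕ} (τ : SignedPerm k) (n : ℕ) : ℕ :=
  Nat.card {π : SignedPerm n // π.IsInvolution ∧ ¬ π.Contains τ}

/-- Wilf equivalence of signed patterns. -/
def wilf (k : ℕ) : Setoid (SignedPerm k) where
  r σ τ := ∀ n : ℕ, 1 ≤ n → σ.numAvoiders n = τ.numAvoiders n
  iseqv := ⟨fun _ _ _ => rfl, fun h n hn => (h n hn).symm,
    fun h₁ h₂ n hn => (h₁ n hn).trans (h₂ n hn)⟩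

/-- Wilf equivalence of signed patterns with respect to signed involutions. -/
def wilfInv (k : ℕ) : Setoid (SignedPerm k) where
  r σ τ := ∀ n : ℕ, 1 ≤ n → σ.numInvAvoiders n = τ.numInvAvoiders n
  iseqv := ⟨fun _ _ _ => rfl, fun h n hn => (h n hn).symm,
    fun h₁ h₂ n hn => (h₁ n hn).trans (h₂ n hn)⟩

/-- The pattern `1 2 3`. -/
def p123 : SignedPerm 3 := ⟨![1, 2, 3], by decide⟩

/-- The pattern `1 -3 2`. -/
def p1b32 : SignedPerm 3 := ⟨![1, -3, 2], by decide⟩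

/-- The pattern `2 3 1`. -/
def p231 : SignedPerm 3 := ⟨![2, 3, 1], by decide⟩

/-- The pattern `-2 3 1`. -/
def pb231 : SignedPerm 3 := ⟨![-2, 3, 1], by decide⟩

/-- The pattern `2 3 -1`. -/
def p23b1 : SignedPerm 3 := ⟨![2, 3, -1], by decide⟩

/-- The pattern `-3 2 1`. -/
def pb321 : SignedPerm 3 := ⟨![-3, 2, 1], by decide⟩

end SignedPerm

/-! A signed permutation is a permutation matrix whose entries carry two colours, and signed
involutions are the symmetric coloured matrices. Reversal, complement, transposition and exchange of
colours preserve the avoidance counts. For involutions only the half-turn, transposition and colour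
exchange survive. Three mechanisms give the remaining equivalences.

Sign flips. Fix the permutation and one letter of the pattern, for example the `1` of `123`. A point
plays that role if it completes the pattern with two positive points. Making every such point
positive, or every such point negative, does not change which points play the role, because a role
player used as one of the other two letters can be replaced. This exchanges avoiders of the pattern
with the chosen letter positive and with it negative, and it respects symmetry (`flipEquiv`,
`flip_equivalence`).

`123` and `132`. Record the signs, the negative points and the staircase below the positive
left-to-right minima. Each such `skeleton` is realised by exactly one avoider of either pattern.
Skeletons are compatible with transposition, so the correspondence preserves involutions.

`321` and `132` for involutions, where reversal is unavailable. The positive positions carry an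
involution of their own, independent of the negative part, so the claim reduces to unsigned
involutions. The `321`-avoiding ones are encoded by their second elements of two-cycles, the
`132`-avoiding ones by the diagonals of their symmetric staircase. Both codes range over all ballot
words.

The classes are separated at `n = 5`: the counts are 3312 and 3311 for signed permutations, and 256,
288, 292, 291, 299, 298 for signed involutions. -/

/-- Signed permutations as pairs of a permutation and a sign vector (`true` meaning positive). -/
abbrev ColPerm (n : ℕ) := Equiv.Perm (Fin n) × (Fin n → Bool)

/-! ### Signed words as coloured permutations -/

namespace ColPerm

variable {n k : ℕ}

/-- Containment of coloured patterns. -/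
def Contains (x : ColPerm n) (p : ColPerm k) : Prop :=
  ∃ ι : Fin k → Fin n, StrictMono ι ∧
    (∀ a b, x.1 (ι a) < x.1 (ι b) ↔ p.1 a < p.1 b) ∧ ∀ a, x.2 (ι a) = p.2 a

/-- Coloured involutions: symmetric coloured permutation matrices. -/
def IsInvol (x : ColPerm n) : Prop :=
  (∀ i, x.1 (x.1 i) = i) ∧ ∀ i, x.2 (x.1 i) = x.2 i

/-- The signed word of a coloured permutation. -/
def toSigned (x : ColPerm n) : SignedPerm n where
  word i := if x.2 i then ((x.1 i : ℕ) + 1 : ℤ) else -((x.1 i : ℕ) + 1 : ℤ)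
  appears j := ⟨x.1.symm j, by
    simp only [Equiv.apply_symm_apply]
    split <;> omega⟩

theorem natAbs_toSigned (x : ColPerm n) (i : Fin n) :
    (x.toSigned.word i).natAbs = (x.1 i : ℕ) + 1 := by
  simp only [toSigned]
  split <;> omega

theorem toSigned_pos (x : ColPerm n) (i : Fin n) :
    0 < x.toSigned.word i ↔ x.2 i = true := by
  simp only [toSigned]
  split <;> rename_i h <;> simp [h]

theorem toSigned_injective : Function.Injective (toSigned (n := n)) := by
  intro x y h
  have h1 : ∀ i, x.1 i = y.1 i := fun i => by
    have := natAbs_toSigned x i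
    rw [h, natAbs_toSigned y i] at this
    exact Fin.ext (by omega)
  have h2 : ∀ i, x.2 i = y.2 i := fun i => by
    have := toSigned_pos x i
    rw [h, toSigned_pos y i] at this
    exact (Bool.eq_iff_iff.2 this).symm
  exact Prod.ext (Equiv.ext h1) (funext h2)

theorem toSigned_surjective : Function.Surjective (toSigned (n := n)) := by
  intro π
  have hb := π.natAbs_mem
  let f : Fin n → Fin n := fun i => ⟨(π.word i).natAbs - 1, by have := hb i; omega⟩
  have hf : Function.Surjective f := fun j => by
    obtain ⟨i, hi⟩ := π.appears j
    exact ⟨i, Fin.ext (by simp only [f]; omega)⟩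
  refine ⟨(Equiv.ofBijective f ⟨Finite.injective_iff_surjective.2 hf, hf⟩,
    fun i => decide (0 < π.word i)), ?_⟩
  ext i
  have := hb i
  have hv : ((Equiv.ofBijective f ⟨Finite.injective_iff_surjective.2 hf, hf⟩ i : Fin n) : ℕ) =
      (π.word i).natAbs - 1 := rfl
  simp only [toSigned, decide_eq_true_eq, hv]
  split <;> omega

/-- Signed words and coloured permutations are the same thing. -/
noncomputable def signedEquiv (n : ℕ) : ColPerm n ≃ SignedPerm n :=
  Equiv.ofBijective toSigned ⟨toSigned_injective, toSigned_surjective⟩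

theorem toSigned_contains (x : ColPerm n) (p : ColPerm k) :
    x.toSigned.Contains p.toSigned ↔ x.Contains p := by
  unfold SignedPerm.Contains Contains
  refine exists_congr fun ι => and_congr_right fun _ => ?_
  simp only [natAbs_toSigned, toSigned_pos, add_lt_add_iff_right, Fin.val_fin_lt]
  constructor
  · exact fun h => ⟨fun a b => (h a b).1, fun a => Bool.eq_iff_iff.2 (h a a).2⟩
  · exact fun h a b => ⟨h.1 a b, by rw [h.2 a]⟩

/-- The Boolean `ε` is the sign of the argument; signs multiply, and `==` is the product when `true`
stands for plus. -/
theorem act_toSigned (x : ColPerm n) (i : Fin n) (ε : Bool) :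
    x.toSigned.act (if ε then ((i : ℕ) + 1 : ℤ) else -((i : ℕ) + 1 : ℤ)) =
      if (ε == x.2 i) then ((x.1 i : ℕ) + 1 : ℤ) else -((x.1 i : ℕ) + 1 : ℤ) := by
  unfold SignedPerm.act
  have hi := i.isLt
  cases ε
  · have h : (-((i : ℕ) + 1 : ℤ)).natAbs = (i : ℕ) + 1 := by omega
    have hs : (-((i : ℕ) + 1 : ℤ)).sign = -1 := Int.sign_eq_neg_one_of_neg (by omega)
    simp only [Bool.false_eq_true, if_false, hs]
    rw [dif_pos (by omega)]
    have e : (⟨(-((i : ℕ) + 1 : ℤ)).natAbs - 1, by omega⟩ : Fin n) = i := Fin.ext (by simp only [h]; omega)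
    rw [e]
    simp only [toSigned]
    cases x.2 i <;> simp
  · have h : ((i : ℕ) + 1 : ℤ).natAbs = (i : ℕ) + 1 := by omega
    have hs : ((i : ℕ) + 1 : ℤ).sign = 1 := Int.sign_eq_one_of_pos (by omega)
    simp only [if_true, hs]
    rw [dif_pos (by omega)]
    have e : (⟨((i : ℕ) + 1 : ℤ).natAbs - 1, by omega⟩ : Fin n) = i := Fin.ext (by simp only [h]; omega)
    rw [e]
    simp only [toSigned]
    cases x.2 i <;> simp

/-- The square of the odd map sends `i` to `σ (σ i)` with sign the product of the signs at `i` and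
at `σ i`, which must therefore agree. -/
theorem toSigned_isInvolution (x : ColPerm n) :
    x.toSigned.IsInvolution ↔ x.IsInvol := by
  have key : ∀ (i : Fin n) (ε : Bool), x.toSigned.act (x.toSigned.act
      (if ε then ((i : ℕ) + 1 : ℤ) else -((i : ℕ) + 1 : ℤ))) =
      if ((ε == x.2 i) == x.2 (x.1 i)) then ((x.1 (x.1 i) : ℕ) + 1 : ℤ)
        else -((x.1 (x.1 i) : ℕ) + 1 : ℤ) := fun i ε => by
    rw [act_toSigned, act_toSigned]
  constructor
  · intro h
    have h' : ∀ i, x.1 (x.1 i) = i ∧ x.2 (x.1 i) = x.2 i := fun i => by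
      have h1 := key i true
      rw [h] at h1
      cases h2 : x.2 i <;> cases h3 : x.2 (x.1 i) <;> simp [h2, h3] at h1 <;>
        first
        | exact ⟨Fin.ext (by omega), rfl⟩
        | omega
    exact ⟨fun i => (h' i).1, fun i => (h' i).2⟩
  · intro h z
    by_cases hz : 1 ≤ z.natAbs ∧ z.natAbs ≤ n
    · have h1 := key ⟨z.natAbs - 1, by omega⟩ (decide (0 < z))
      have h2 : (if decide (0 < z) = true then ((z.natAbs - 1 : ℕ) + 1 : ℤ)
          else -((z.natAbs - 1 : ℕ) + 1 : ℤ)) = z := by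
        simp only [decide_eq_true_eq]
        split <;> omega
      simp only [h.1, h.2, h2] at h1
      rw [h1]
      conv_rhs => rw [← h2]
      cases decide (0 < z) <;> cases x.2 ⟨z.natAbs - 1, by omega⟩ <;> rfl
    · have h1 : x.toSigned.act z = z := by
        unfold SignedPerm.act
        rw [dif_neg hz]
      rw [h1, h1]

/-- The number of `p`-avoiding coloured permutations. -/
noncomputable def numAv (p : ColPerm k) (n : ℕ) : ℕ :=
  Nat.card {x : ColPerm n // ¬ x.Contains p}

/-- The number of `p`-avoiding coloured involutions. -/
noncomputable def numInvAv (p : ColPerm k) (n : ℕ) : ℕ :=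
  Nat.card {x : ColPerm n // x.IsInvol ∧ ¬ x.Contains p}

theorem numAvoiders_toSigned (p : ColPerm k) (n : ℕ) :
    p.toSigned.numAvoiders n = p.numAv n :=
  (Nat.card_congr ((signedEquiv n).subtypeEquiv fun x =>
    not_congr (toSigned_contains x p).symm)).symm

theorem numInvAvoiders_toSigned (p : ColPerm k) (n : ℕ) :
    p.toSigned.numInvAvoiders n = p.numInvAv n :=
  (Nat.card_congr ((signedEquiv n).subtypeEquiv fun x =>
    and_congr (toSigned_isInvolution x).symm (not_congr (toSigned_contains x p).symm))).symm

/-! ### Symmetries of pattern avoidance -/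

/-- Reversal of words. -/
def rev (x : ColPerm n) : ColPerm n := (Fin.revPerm.trans x.1, x.2 ∘ Fin.rev)

/-- Complementation of absolute values. -/
def compl (x : ColPerm n) : ColPerm n := (x.1.trans Fin.revPerm, x.2)

/-- Inversion, that is, transposition of the coloured permutation matrix. -/
def inv (x : ColPerm n) : ColPerm n := (x.1.symm, x.2 ∘ x.1.symm)

/-- Negation of all letters. -/
def bar (x : ColPerm n) : ColPerm n := (x.1, fun i => !x.2 i)

theorem rev_involutive : Function.Involutive (rev (n := n)) := fun x =>
  Prod.ext (Equiv.ext fun i => by simp [rev]) (funext fun i => by simp [rev])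

theorem compl_involutive : Function.Involutive (compl (n := n)) := fun x =>
  Prod.ext (Equiv.ext fun i => by simp [compl]) rfl

theorem inv_involutive : Function.Involutive (inv (n := n)) := fun x =>
  Prod.ext rfl (funext fun i => by simp [inv])

theorem bar_involutive : Function.Involutive (bar (n := n)) := fun x =>
  Prod.ext rfl (funext fun i => by simp [bar])

theorem Contains.rev {x : ColPerm n} {p : ColPerm k} (h : x.Contains p) :
    x.rev.Contains p.rev := by
  obtain ⟨ι, h1, h2, h3⟩ := h
  refine ⟨fun a => (ι a.rev).rev, fun a b hab => ?_, fun a b => ?_, fun a => ?_⟩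
  · exact Fin.rev_lt_rev.2 (h1 (Fin.rev_lt_rev.2 hab))
  · simpa [ColPerm.rev] using h2 a.rev b.rev
  · simpa [ColPerm.rev] using h3 a.rev

theorem Contains.compl {x : ColPerm n} {p : ColPerm k} (h : x.Contains p) :
    x.compl.Contains p.compl := by
  obtain ⟨ι, h1, h2, h3⟩ := h
  refine ⟨ι, h1, fun a b => ?_, h3⟩
  simpa [ColPerm.compl] using h2 b a

theorem Contains.inv {x : ColPerm n} {p : ColPerm k} (h : x.Contains p) :
    x.inv.Contains p.inv := by
  obtain ⟨ι, h1, h2, h3⟩ := h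
  refine ⟨fun a => x.1 (ι (p.1.symm a)), fun a b hab => ?_, fun a b => ?_, fun a => ?_⟩
  · rw [h2]
    simpa using hab
  · simpa [ColPerm.inv] using h1.lt_iff_lt
  · simpa [ColPerm.inv] using h3 _

theorem Contains.bar {x : ColPerm n} {p : ColPerm k} (h : x.Contains p) :
    x.bar.Contains p.bar := by
  obtain ⟨ι, h1, h2, h3⟩ := h
  exact ⟨ι, h1, h2, fun a => congrArg Bool.not (h3 a)⟩

theorem IsInvol.inv_eq {x : ColPerm n} (h : x.IsInvol) : x.inv = x := by
  have h1 : x.1.symm = x.1 := Equiv.ext fun i => by rw [Equiv.symm_apply_eq, h.1]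
  refine Prod.ext h1 (funext fun i => ?_)
  simp [ColPerm.inv, h1, h.2]

theorem isInvol_of_inv_eq {x : ColPerm n} (h : x.inv = x) : x.IsInvol := by
  have h1 : x.1.symm = x.1 := congrArg Prod.fst h
  refine ⟨fun i => ?_, fun i => ?_⟩
  · rw [← Equiv.eq_symm_apply, h1]
  · conv_rhs => rw [← h]
    simp [ColPerm.inv, h1]

/-- Reversal and complement each reflect the matrix in an axis that does not preserve its symmetry;
their composite is the half-turn, which commutes with transposition. -/
theorem IsInvol.rev_compl {x : ColPerm n} (h : x.IsInvol) : x.rev.compl.IsInvol := by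
  refine ⟨fun i => ?_, fun i => ?_⟩
  · simp [ColPerm.rev, ColPerm.compl, h.1]
  · simp [ColPerm.rev, ColPerm.compl, h.2]

theorem IsInvol.bar {x : ColPerm n} (h : x.IsInvol) : x.bar.IsInvol :=
  ⟨h.1, fun i => congrArg Bool.not (h.2 i)⟩

theorem rev_compl_involutive : Function.Involutive fun x : ColPerm n => x.rev.compl := fun x =>
  Prod.ext (Equiv.ext fun i => by simp [rev, compl]) (funext fun i => by simp [rev, compl])

theorem numAv_map (F : ∀ {m : ℕ}, ColPerm m → ColPerm m)
    (hF : ∀ {m : ℕ}, Function.Involutive (F (m := m)))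
    (hc : ∀ {m l : ℕ} {x : ColPerm m} {p : ColPerm l}, x.Contains p → (F x).Contains (F p))
    (p : ColPerm k) (n : ℕ) : (F p).numAv n = p.numAv n :=
  (Nat.card_congr ((hF.toPerm F).subtypeEquiv fun x => not_congr
    ⟨hc, fun h => by simpa [hF _] using hc h⟩)).symm

theorem numInvAv_map (F : ∀ {m : ℕ}, ColPerm m → ColPerm m)
    (hF : ∀ {m : ℕ}, Function.Involutive (F (m := m)))
    (hc : ∀ {m l : ℕ} {x : ColPerm m} {p : ColPerm l}, x.Contains p → (F x).Contains (F p))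
    (hi : ∀ {m : ℕ} {x : ColPerm m}, x.IsInvol → (F x).IsInvol)
    (p : ColPerm k) (n : ℕ) : (F p).numInvAv n = p.numInvAv n :=
  (Nat.card_congr ((hF.toPerm F).subtypeEquiv fun x => and_congr
    ⟨hi, fun h => by simpa [hF _] using hi h⟩ <| not_congr
    ⟨hc, fun h => by simpa [hF _] using hc h⟩)).symm

theorem numAv_rev (p : ColPerm k) (n : ℕ) : p.rev.numAv n = p.numAv n :=
  numAv_map rev rev_involutive Contains.rev p n

theorem numAv_compl (p : ColPerm k) (n : ℕ) : p.compl.numAv n = p.numAv n :=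
  numAv_map compl compl_involutive Contains.compl p n

theorem numAv_inv (p : ColPerm k) (n : ℕ) : p.inv.numAv n = p.numAv n :=
  numAv_map inv inv_involutive Contains.inv p n

theorem numAv_bar (p : ColPerm k) (n : ℕ) : p.bar.numAv n = p.numAv n :=
  numAv_map bar bar_involutive Contains.bar p n

theorem numInvAv_rev_compl (p : ColPerm k) (n : ℕ) : p.rev.compl.numInvAv n = p.numInvAv n :=
  numInvAv_map (fun x => x.rev.compl) rev_compl_involutive (fun h => h.rev.compl)
    IsInvol.rev_compl p n

theorem numInvAv_inv (p : ColPerm k) (n : ℕ) : p.inv.numInvAv n = p.numInvAv n :=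
  numInvAv_map inv inv_involutive Contains.inv (fun h => by rwa [h.inv_eq]) p n

theorem numInvAv_bar (p : ColPerm k) (n : ℕ) : p.bar.numInvAv n = p.numInvAv n :=
  numInvAv_map bar bar_involutive Contains.bar IsInvol.bar p n

/-- Containment of a pattern of length three, spelled out. -/
theorem contains_three (x : ColPerm n) (p : ColPerm 3) :
    x.Contains p ↔ ∃ i j k, i < j ∧ j < k ∧ (x.1 i < x.1 j ↔ p.1 0 < p.1 1) ∧
      (x.1 i < x.1 k ↔ p.1 0 < p.1 2) ∧ (x.1 j < x.1 k ↔ p.1 1 < p.1 2) ∧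
      x.2 i = p.2 0 ∧ x.2 j = p.2 1 ∧ x.2 k = p.2 2 := by
  constructor
  · rintro ⟨ι, h1, h2, h3⟩
    exact ⟨ι 0, ι 1, ι 2, h1 (by decide), h1 (by decide), h2 _ _, h2 _ _, h2 _ _, h3 _, h3 _, h3 _⟩
  · rintro ⟨i, j, k, hij, hjk, h1, h2, h3, h4⟩
    -- The three forward comparisons determine the reversed ones, since distinct positions carry
    -- distinct values.
    have flip : ∀ {m : ℕ} (σ : Equiv.Perm (Fin m)) {a b : Fin m}, a ≠ b →
        (σ b < σ a ↔ ¬ σ a < σ b) := fun σ a b hab => by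
      have := σ.injective.ne hab
      constructor
      · exact fun h => h.le.not_gt
      · exact fun h => lt_of_le_of_ne (not_lt.1 h) this.symm
    have hik := hij.trans hjk
    refine ⟨![i, j, k], ?_, ?_, ?_⟩
    · rw [Fin.strictMono_iff_lt_succ]
      intro a
      fin_cases a
      · exact hij
      · exact hjk
    · intro a b
      fin_cases a <;> fin_cases b
      · simp
      · simpa using h1
      · simpa using h2
      · simpa [flip x.1 hij.ne, flip p.1 (show (0 : Fin 3) ≠ 1 by decide)] using not_congr h1
      · simp
      · simpa using h3
      · simpa [flip x.1 hik.ne, flip p.1 (show (0 : Fin 3) ≠ 2 by decide)] using not_congr h2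
      · simpa [flip x.1 hjk.ne, flip p.1 (show (1 : Fin 3) ≠ 2 by decide)] using not_congr h3
      · simp
    · intro a
      fin_cases a
      · exact h4.1
      · exact h4.2.1
      · exact h4.2.2

end ColPerm

/-! ### Flipping the sign of one letter -/

namespace ColPerm

section Flip

variable {X : Type*} (R : X → X → X → Prop)

/-- The points that, together with two marked points, form a configuration `R`. -/
def Role (s : X → Bool) (p : X) : Prop := ∃ e f, R p e f ∧ s e = true ∧ s f = true

variable {R} (μ : X → X → ℕ)
  (hR : ∀ p e f x y z, R p e f → (x = e ∨ x = f) → R x y z → ∃ u v, R p u v ∧ μ u v < μ e f ∧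
    (u = e ∨ u = f ∨ u = y ∨ u = z) ∧ (v = e ∨ v = f ∨ v = y ∨ v = z))

include hR

/-- A configuration all of whose points satisfy `Q` can be replaced by one that moreover avoids the
points playing the first role. -/
theorem exists_not_role (Q Q' : X → Prop) (h : ∀ x, Q x → Q' x ∨ ∃ y z, R x y z ∧ Q y ∧ Q z) (p : X) :
    ∀ m e f, μ e f = m → R p e f → Q e → Q f → ∃ e f, R p e f ∧ Q' e ∧ Q' f := by
  intro m
  induction m using Nat.strong_induction_on with
  | _ m ih =>
    intro e f hm hp he hf
    by_cases hx : Q' e ∧ Q' f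
    · exact ⟨e, f, hp, hx.1, hx.2⟩
    · have : ∃ x, (x = e ∨ x = f) ∧ ¬ Q' x := by
        by_contra! hne
        exact hx ⟨hne e (.inl rfl), hne f (.inr rfl)⟩
      obtain ⟨x, hx, hx'⟩ := this
      have hQx : Q x := by rcases hx with rfl | rfl <;> assumption
      obtain ⟨y, z, hxyz, hy, hz⟩ := (h x hQx).resolve_left hx'
      -- The point `x` fails `Q'`, so it plays the first role itself; trading it for its partners
      -- lowers `μ`, and the descent terminates.
      obtain ⟨u, v, h1, h2, h3, h4⟩ := hR p e f x y z hp hx hxyz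
      refine ih _ (hm ▸ h2) u v rfl h1 ?_ ?_
      · rcases h3 with rfl | rfl | rfl | rfl <;> assumption
      · rcases h4 with rfl | rfl | rfl | rfl <;> assumption

-- Marking the role players creates no new role player: a configuration using newly marked points
-- descends to one using only points of `s`.
open Classical in
theorem role_union (s : X → Bool) (p : X) :
    Role R (fun x => s x || decide (Role R s x)) p ↔ Role R s p := by
  constructor
  · rintro ⟨e, f, hp, he, hf⟩
    refine exists_not_role μ hR (fun x => (s x || decide (Role R s x)) = true)
      (fun x => s x = true) (fun x hx => ?_) p _ e f rfl hp he hf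
    simp only [Bool.or_eq_true, decide_eq_true_eq] at hx
    refine hx.imp_right fun ⟨y, z, h1, h2, h3⟩ => ⟨y, z, h1, ?_, ?_⟩ <;> simp [*]
  · rintro ⟨e, f, hp, he, hf⟩
    exact ⟨e, f, hp, by simp [he], by simp [hf]⟩

-- Unmarking the role players destroys no role, as every configuration descends to one whose two
-- marked points play no role themselves.
open Classical in
theorem role_diff (s : X → Bool) (p : X) :
    Role R (fun x => s x && !decide (Role R s x)) p ↔ Role R s p := by
  constructor
  · rintro ⟨e, f, hp, he, hf⟩
    simp only [Bool.and_eq_true] at he hf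
    exact ⟨e, f, hp, he.1, hf.1⟩
  · rintro ⟨e, f, hp, he, hf⟩
    refine exists_not_role μ hR (fun x => s x = true)
      (fun x => (s x && !decide (Role R s x)) = true) (fun x hx => ?_) p _ e f rfl hp he hf
    by_cases h : Role R s x
    · exact .inr h
    · exact .inl (by simp [hx, h])

open Classical in
/-- Marking all points in the first role turns sets without marked points in that role into sets
with only marked points in that role. -/
noncomputable def flipEquiv (I : (X → Bool) → Prop)
    (hI : ∀ s, I s → I (fun x => s x || decide (Role R s x)))
    (hI' : ∀ s, I s → I (fun x => s x && !decide (Role R s x))) :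
    {s : X → Bool // I s ∧ ∀ p, Role R s p → s p = false} ≃
      {s : X → Bool // I s ∧ ∀ p, Role R s p → s p = true} where
  toFun s := ⟨fun x => s.1 x || decide (Role R s.1 x), hI _ s.2.1, fun p hp => by
    have := (role_union μ hR s.1 p).1 hp
    simp [this]⟩
  invFun s := ⟨fun x => s.1 x && !decide (Role R s.1 x), hI' _ s.2.1, fun p hp => by
    have := (role_diff μ hR s.1 p).1 hp
    simp [this]⟩
  left_inv s := by
    refine Subtype.ext (funext fun x => ?_)
    simp only [role_union μ hR]
    by_cases h : Role R s.1 x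
    · simp [h, s.2.2 x h]
    · simp [h]
  right_inv s := by
    refine Subtype.ext (funext fun x => ?_)
    simp only [role_diff μ hR]
    by_cases h : Role R s.1 x
    · simp [h, s.2.2 x h]
    · simp [h]

end Flip

/-- If avoidance of `p` and of `q` means that no (respectively every) point playing a given role is
positive, then `p` and `q` are equivalent for signed permutations and for signed involutions. -/
theorem flip_equivalence {n : ℕ} (p q : ColPerm 3)
    (R : Equiv.Perm (Fin n) → Fin n → Fin n → Fin n → Prop) (μ : Fin n → Fin n → ℕ)
    (hR : ∀ σ p e f x y z, R σ p e f → (x = e ∨ x = f) → R σ x y z →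
      ∃ u v, R σ p u v ∧ μ u v < μ e f ∧
      (u = e ∨ u = f ∨ u = y ∨ u = z) ∧ (v = e ∨ v = f ∨ v = y ∨ v = z))
    (hs : ∀ σ : Equiv.Perm (Fin n), (∀ i, σ (σ i) = i) → ∀ p e f, R σ p e f →
      R σ (σ p) (σ e) (σ f) ∨ R σ (σ p) (σ f) (σ e))
    (hp : ∀ x : ColPerm n, x.Contains p ↔ ∃ i, Role (R x.1) x.2 i ∧ x.2 i = true)
    (hq : ∀ x : ColPerm n, x.Contains q ↔ ∃ i, Role (R x.1) x.2 i ∧ x.2 i = false) :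
    p.numAv n = q.numAv n ∧ p.numInvAv n = q.numInvAv n := by
  have hp' : ∀ x : ColPerm n, ¬ x.Contains p ↔ ∀ i, Role (R x.1) x.2 i → x.2 i = false := by
    simp [hp]
  have hq' : ∀ x : ColPerm n, ¬ x.Contains q ↔ ∀ i, Role (R x.1) x.2 i → x.2 i = true := by
    simp [hq]
  have sig : ∀ (I : ColPerm n → Prop) (Q : ColPerm n → Prop),
      Nonempty ({x : ColPerm n // I x ∧ Q x} ≃
        Σ σ : Equiv.Perm (Fin n), {s : Fin n → Bool // I (σ, s) ∧ Q (σ, s)}) := fun I Q =>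
    ⟨{ toFun := fun x => ⟨x.1.1, x.1.2, x.2⟩
       invFun := fun y => ⟨(y.1, y.2.1), y.2.2⟩
       left_inv := fun _ => rfl
       right_inv := fun _ => rfl }⟩
  -- The property `I` covers both counts, being trivial for all signed permutations and `IsInvol`
  -- for involutions; the condition on `t` says that only the symmetry of the sign vector has to be
  -- kept.
  have main : ∀ I : ColPerm n → Prop,
      (∀ σ s, I (σ, s) → ∀ t : Fin n → Bool,
        ((∀ i, s (σ i) = s i) → (∀ i, σ (σ i) = i) → ∀ i, t (σ i) = t i) → I (σ, t)) →
      Nat.card {x : ColPerm n // I x ∧ ¬ x.Contains p} =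
        Nat.card {x : ColPerm n // I x ∧ ¬ x.Contains q} := by
    intro I hI
    obtain ⟨e₁⟩ := sig I (fun x => ¬ x.Contains p)
    obtain ⟨e₂⟩ := sig I (fun x => ¬ x.Contains q)
    simp only [hp', hq'] at e₁ e₂ ⊢
    have role_inv : ∀ (σ : Equiv.Perm (Fin n)) (s : Fin n → Bool), (∀ i, s (σ i) = s i) →
        (∀ i, σ (σ i) = i) → ∀ i, Role (R σ) s (σ i) ↔ Role (R σ) s i := by
      intro σ s h1 h2
      have : ∀ i, Role (R σ) s i → Role (R σ) s (σ i) := by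
        rintro i ⟨e, f, h3, he, hf⟩
        rcases hs σ h2 i e f h3 with h | h
        · exact ⟨_, _, h, by rw [h1, he], by rw [h1, hf]⟩
        · exact ⟨_, _, h, by rw [h1, hf], by rw [h1, he]⟩
      exact fun i => ⟨fun h => by simpa [h2] using this _ h, this i⟩
    refine Nat.card_congr (e₁.trans ((Equiv.sigmaCongrRight fun σ => ?_).trans e₂.symm))
    refine flipEquiv μ (hR σ) (fun s => I (σ, s)) (fun s h => hI σ s h _ ?_)
      (fun s h => hI σ s h _ ?_)
    · intro h1 h2 i
      rw [h1, decide_eq_decide.2 (role_inv σ s h1 h2 i)]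
    · intro h1 h2 i
      rw [h1, decide_eq_decide.2 (role_inv σ s h1 h2 i)]
  constructor
  · have := main (fun _ => True) (fun _ _ _ _ _ => trivial)
    simpa [numAv] using this
  · exact main IsInvol fun σ s h t ht => ⟨h.1, ht h.2 h.1⟩

/-- The patterns `123`, `132`, `321` with given signs, and some others. -/
def c123 (a b c : Bool) : ColPerm 3 := (1, ![a, b, c])
def c132 (a b c : Bool) : ColPerm 3 := (Equiv.swap 1 2, ![a, b, c])
def c321 (a b c : Bool) : ColPerm 3 := (Equiv.swap 0 2, ![a, b, c])
def c231 (a b c : Bool) : ColPerm 3 := (finRotate 3, ![a, b, c])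

section

variable {n : ℕ}

theorem contains_c123 (x : ColPerm n) (a b c : Bool) :
    x.Contains (c123 a b c) ↔ ∃ i j k, i < j ∧ j < k ∧ x.1 i < x.1 j ∧ x.1 j < x.1 k ∧
      x.2 i = a ∧ x.2 j = b ∧ x.2 k = c := by
  rw [contains_three]
  refine exists_congr fun i => exists_congr fun j => exists_congr fun k =>
    and_congr_right fun _ => and_congr_right fun _ => ?_
  simp only [c123, Equiv.Perm.coe_one, id, show (0 : Fin 3) < 1 by decide,
    show (0 : Fin 3) < 2 by decide, show (1 : Fin 3) < 2 by decide, iff_true]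
  constructor
  · exact fun ⟨h1, _, h3, h4⟩ => ⟨h1, h3, h4⟩
  · exact fun ⟨h1, h3, h4⟩ => ⟨h1, h1.trans h3, h3, h4⟩

theorem contains_c132 (x : ColPerm n) (a b c : Bool) :
    x.Contains (c132 a b c) ↔ ∃ i j k, i < j ∧ j < k ∧ x.1 i < x.1 k ∧ x.1 k < x.1 j ∧
      x.2 i = a ∧ x.2 j = b ∧ x.2 k = c := by
  rw [contains_three]
  refine exists_congr fun i => exists_congr fun j => exists_congr fun k =>
    and_congr_right fun _ => and_congr_right fun hjk => ?_
  have := x.1.injective.ne hjk.ne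
  simp only [c132, show Equiv.swap (1 : Fin 3) 2 0 < Equiv.swap (1 : Fin 3) 2 1 by decide,
    show Equiv.swap (1 : Fin 3) 2 0 < Equiv.swap (1 : Fin 3) 2 2 by decide,
    show ¬ Equiv.swap (1 : Fin 3) 2 1 < Equiv.swap (1 : Fin 3) 2 2 by decide, iff_true, iff_false]
  constructor
  · exact fun ⟨_, h2, h3, h4⟩ => ⟨h2, by omega, h4⟩
  · exact fun ⟨h1, h3, h4⟩ => ⟨h1.trans h3, h1, by omega, h4⟩

theorem contains_c321 (x : ColPerm n) (a b c : Bool) :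
    x.Contains (c321 a b c) ↔ ∃ i j k, i < j ∧ j < k ∧ x.1 k < x.1 j ∧ x.1 j < x.1 i ∧
      x.2 i = a ∧ x.2 j = b ∧ x.2 k = c := by
  rw [contains_three]
  refine exists_congr fun i => exists_congr fun j => exists_congr fun k =>
    and_congr_right fun hij => and_congr_right fun hjk => ?_
  have := x.1.injective.ne hjk.ne
  have := x.1.injective.ne hij.ne
  simp only [c321, show ¬ Equiv.swap (0 : Fin 3) 2 0 < Equiv.swap (0 : Fin 3) 2 1 by decide,
    show ¬ Equiv.swap (0 : Fin 3) 2 0 < Equiv.swap (0 : Fin 3) 2 2 by decide,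
    show ¬ Equiv.swap (0 : Fin 3) 2 1 < Equiv.swap (0 : Fin 3) 2 2 by decide, iff_false]
  constructor
  · exact fun ⟨h1, _, h3, h4⟩ => ⟨by omega, by omega, h4⟩
  · exact fun ⟨h1, h3, h4⟩ => ⟨by omega, by omega, by omega, h4⟩

/-- If `e` or `f` itself starts a `123`, the two later points of that occurrence lie to its upper
right, hence also to that of `p`. The first marked point moves right, which lowers `n - e`. -/
theorem flip_c123_first (n : ℕ) :
    (c123 true true true).numAv n = (c123 false true true).numAv n ∧
      (c123 true true true).numInvAv n = (c123 false true true).numInvAv n := by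
  refine flip_equivalence _ _ (fun σ p e f => p < e ∧ e < f ∧ σ p < σ e ∧ σ e < σ f)
    (fun e _ => n - e) ?_ ?_ (fun x => ?_) (fun x => ?_)
  · rintro σ p e f x y z h hx h'
    refine ⟨y, z, ?_⟩
    rcases hx with rfl | rfl <;> refine ⟨?_, ?_, by simp, by simp⟩ <;> omega
  · intro σ h p e f h'
    simp only [h]
    tauto
  · rw [contains_c123]; unfold Role; grind
  · rw [contains_c123]; unfold Role; grind

/-- A marked point that is a middle letter is replaced by its own outer neighbour on the same side
of `p`, so the gap from `e` to `f` widens. -/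
theorem flip_c123_middle (n : ℕ) :
    (c123 true true true).numAv n = (c123 true false true).numAv n ∧
      (c123 true true true).numInvAv n = (c123 true false true).numInvAv n := by
  refine flip_equivalence _ _ (fun σ p e f => e < p ∧ p < f ∧ σ e < σ p ∧ σ p < σ f)
    (fun e f => e + (n - f)) ?_ ?_ (fun x => ?_) (fun x => ?_)
  · rintro σ p e f x y z h hx h'
    rcases hx with rfl | rfl
    · refine ⟨y, f, ?_, ?_, by simp, by simp⟩ <;> omega
    · refine ⟨e, z, ?_, ?_, by simp, by simp⟩ <;> omega
  · intro σ h p e f h'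
    simp only [h]
    tauto
  · rw [contains_c123]; unfold Role; grind
  · rw [contains_c123]; unfold Role; grind

/-- As for the first letter of `123`, both replacement points lie to the upper right. Transposition
exchanges the letters `3` and `2`, hence the second alternative in the symmetry hypothesis. -/
theorem flip_c132_first (n : ℕ) :
    (c132 true true true).numAv n = (c132 false true true).numAv n ∧
      (c132 true true true).numInvAv n = (c132 false true true).numInvAv n := by
  refine flip_equivalence _ _ (fun σ p e f => p < e ∧ e < f ∧ σ p < σ f ∧ σ f < σ e)
    (fun e _ => n - e) ?_ ?_ (fun x => ?_) (fun x => ?_)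
  · rintro σ p e f x y z h hx h'
    refine ⟨y, z, ?_⟩
    rcases hx with rfl | rfl <;> refine ⟨?_, ?_, by simp, by simp⟩ <;> omega
  · intro σ h p e f h'
    simp only [h]
    tauto
  · rw [contains_c132]; unfold Role; grind
  · rw [contains_c132]; unfold Role; grind

theorem flip_c321_middle (n : ℕ) :
    (c321 true true true).numAv n = (c321 true false true).numAv n ∧
      (c321 true true true).numInvAv n = (c321 true false true).numInvAv n := by
  refine flip_equivalence _ _ (fun σ p e f => e < p ∧ p < f ∧ σ f < σ p ∧ σ p < σ e)
    (fun e f => e + (n - f)) ?_ ?_ (fun x => ?_) (fun x => ?_)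
  · rintro σ p e f x y z h hx h'
    rcases hx with rfl | rfl
    · refine ⟨y, f, ?_, ?_, by simp, by simp⟩ <;> omega
    · refine ⟨e, z, ?_, ?_, by simp, by simp⟩ <;> omega
  · intro σ h p e f h'
    simp only [h]
    tauto
  · rw [contains_c321]; unfold Role; grind
  · rw [contains_c321]; unfold Role; grind

end

end ColPerm

/-! ### Skeletons: positive `123` against positive `132` -/

/-- The moment `∑ i σ(i)` of a permutation; it increases when an inversion is removed. -/
def Equiv.Perm.moment {n : ℕ} (σ : Equiv.Perm (Fin n)) : ℕ := ∑ i : Fin n, (i : ℕ) * (σ i : ℕ)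

theorem Equiv.Perm.moment_lt_moment_mul_swap {n : ℕ} (σ : Equiv.Perm (Fin n)) {i k : Fin n}
    (hik : i < k) (h : σ k < σ i) : σ.moment < (σ * Equiv.swap i k).moment := by
  have key : ((σ * Equiv.swap i k).moment : ℤ) - σ.moment =
      ((i : ℤ) * σ k - i * σ i) + (k * σ i - k * σ k) := by
    simp only [moment]
    push_cast
    rw [← Finset.sum_sub_distrib, Fintype.sum_eq_add i k hik.ne]
    · simp
    · rintro x ⟨h1, h2⟩
      simp [Equiv.swap_apply_of_ne_of_ne h1 h2]
  have h1 : (0 : ℤ) < ((k : ℤ) - i) * (σ i - σ k) := by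
    apply mul_pos <;> simp only [sub_pos, Nat.cast_lt, Fin.val_fin_lt] <;> assumption
  have : (σ.moment : ℤ) < (σ * Equiv.swap i k).moment := by linarith
  exact_mod_cast this

/-- Two subsets meeting the same fibres of a map in at most one point each are equinumerous. -/
theorem Nat.card_subtype_eq_of_sections {X S : Type*} (f : X → S) (P Q : X → Prop)
    (hPQ : ∀ x, P x → ∃ y, Q y ∧ f y = f x) (hQP : ∀ x, Q x → ∃ y, P y ∧ f y = f x)
    (hP : ∀ x y, P x → P y → f x = f y → x = y) (hQ : ∀ x y, Q x → Q y → f x = f y → x = y) :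
    Nat.card {x // P x} = Nat.card {x // Q x} := by
  choose g hg using hPQ
  refine Nat.card_eq_of_bijective
    (fun x : {x // P x} => (⟨g x.1 x.2, (hg x.1 x.2).1⟩ : {x // Q x})) ⟨?_, ?_⟩
  · intro x y h
    have h' := congrArg (fun z => f z.1) h
    simp only [(hg _ _).2] at h'
    exact Subtype.ext (hP _ _ x.2 y.2 h')
  · intro y
    obtain ⟨x, hx, hxy⟩ := hQP y.1 y.2
    exact ⟨⟨x, hx⟩, Subtype.ext (hQ _ _ (hg x hx).1 y.2 ((hg x hx).2.trans hxy))⟩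

namespace ColPerm

variable {n : ℕ}

/-- The cell `(i, j)` has no positive point weakly to its lower left. -/
def LowerEmpty (x : ColPerm n) (i j : Fin n) : Prop := ∀ k ≤ i, x.2 k = true → j < x.1 k

/-- The sign vector, the negative points and the staircase below the left-to-right minima of the
positive points. -/
def skeleton (x : ColPerm n) : (Fin n → Bool) × (Fin n → Option (Fin n)) × (Fin n → Fin n → Prop) :=
  (x.2, fun i => if x.2 i then none else some (x.1 i), x.LowerEmpty)

theorem skeleton_eq_iff (x y : ColPerm n) :
    x.skeleton = y.skeleton ↔ x.2 = y.2 ∧ (∀ i, x.2 i = false → x.1 i = y.1 i) ∧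
      ∀ i j, x.LowerEmpty i j ↔ y.LowerEmpty i j := by
  simp only [skeleton, Prod.mk.injEq]
  refine and_congr_right fun h => and_congr ?_ ?_
  · rw [funext_iff]
    refine forall_congr' fun i => ?_
    rw [← h]
    cases x.2 i <;> simp
  · simp [funext_iff]

theorem inv_lowerEmpty (x : ColPerm n) (i j : Fin n) :
    x.inv.LowerEmpty i j ↔ x.LowerEmpty j i := by
  simp only [LowerEmpty, inv, Function.comp]
  constructor
  · intro h k hk hx
    by_contra! hlt
    exact (h (x.1 k) hlt (by simpa using hx)).not_ge (by simpa using hk)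
  · intro h k hk hx
    by_contra! hlt
    exact (h _ hlt hx).not_ge (by simpa using hk)

theorem skeleton_inv {x y : ColPerm n} (h : x.skeleton = y.skeleton) :
    x.inv.skeleton = y.inv.skeleton := by
  rw [skeleton_eq_iff] at h ⊢
  obtain ⟨h1, h2, h3⟩ := h
  have h4 : ∀ j, x.2 (x.1.symm j) = false → x.1.symm j = y.1.symm j := fun j hj => by
    rw [Equiv.eq_symm_apply, ← h2 _ hj, Equiv.apply_symm_apply]
  have h5 : ∀ j, y.2 (y.1.symm j) = false → x.1.symm j = y.1.symm j := fun j hj => by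
    rw [Equiv.symm_apply_eq, h2 _ (by rw [h1, hj]), Equiv.apply_symm_apply]
  refine ⟨funext fun j => ?_, fun j hj => h4 j hj, fun i j => ?_⟩
  · simp only [inv, Function.comp]
    by_cases hx : x.2 (x.1.symm j) = false
    · rw [← h4 j hx, h1]
    · by_cases hy : y.2 (y.1.symm j) = false
      · rw [← h5 j hy, h1]
      · simp_all
  · rw [inv_lowerEmpty, inv_lowerEmpty, h3]

/-- Two signed permutations with the same skeleton: at the first disagreement, the one with the
smaller letter contains `123` and the other one contains `132`. -/
theorem contains_of_skeleton_eq {x y : ColPerm n} (h : x.skeleton = y.skeleton) {i : Fin n}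
    (hi : ∀ k < i, x.1 k = y.1 k) (hlt : x.1 i < y.1 i) :
    x.Contains (c123 true true true) ∧ y.Contains (c132 true true true) := by
  rw [skeleton_eq_iff] at h
  obtain ⟨h1, h2, h3⟩ := h
  have hxi : x.2 i = true := by
    by_contra hx
    exact hlt.ne (h2 i (by simpa using hx))
  -- The words agree before `i`, so the letter of `u` at `i` stands after `i` in `v`. It is positive
  -- there, since the negative points coincide.
  have later : ∀ {u v : ColPerm n}, u.2 = v.2 → (∀ k < i, u.1 k = v.1 k) → u.1 i ≠ v.1 i →
      (∀ i, u.2 i = false → u.1 i = v.1 i) → u.2 i = true →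
      ∃ k, i < k ∧ v.1 k = u.1 i ∧ u.2 k = true := by
    intro u v huv hk hne hneg hui
    refine ⟨v.1.symm (u.1 i), ?_, by simp, ?_⟩
    · rcases lt_trichotomy i (v.1.symm (u.1 i)) with h | h | h
      · exact h
      · exact absurd (by conv_rhs => rw [h]
                         simp) hne
      · have := hk _ h
        rw [Equiv.apply_symm_apply] at this
        exact absurd (u.1.injective this) h.ne
    · by_contra hf
      have hf' : u.2 (v.1.symm (u.1 i)) = false := by simpa using hf
      have := hneg _ hf'
      rw [Equiv.apply_symm_apply] at this
      rw [u.1.injective this, hui] at hf'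
      exact absurd hf' (by decide)
  obtain ⟨k, hk, hk1, hk2⟩ := later h1 hi hlt.ne h2 hxi
  obtain ⟨l, hl, hl1, hl2⟩ := later h1.symm (fun k hk => (hi k hk).symm) hlt.ne'
    (fun j hj => (h2 j (by rw [h1, hj])).symm) (h1 ▸ hxi)
  -- The positive point of `x` at `i` occupies this cell, so `y`, having the same staircase, has a
  -- positive point weakly to its lower left. It serves as the letter `1` in both patterns.
  have hne : ¬ y.LowerEmpty i (x.1 i) := fun h => lt_irrefl _ ((h3 _ _).2 h i le_rfl hxi)
  unfold LowerEmpty at hne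
  push Not at hne
  obtain ⟨j, hj, hj1, hj2⟩ := hne
  have hji : j < i := lt_of_le_of_ne hj fun e => by rw [e] at hj2; exact hlt.not_ge hj2
  have hlt' : y.1 j < x.1 i := lt_of_le_of_ne hj2 fun e => by
    rw [← hk1] at e
    exact (hji.trans hk).ne (y.1.injective e)
  rw [contains_c123, contains_c132]
  refine ⟨⟨j, i, l, hji, hl, by rwa [hi j hji], by rwa [hl1], by rw [h1, hj1], hxi, by rw [h1, hl2]⟩,
    ⟨j, i, k, hji, hk, by rwa [hk1], by rwa [hk1], hj1, by rw [← h1, hxi], by rw [← h1, hk2]⟩⟩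

theorem eq_of_skeleton_eq {x y : ColPerm n} (h : x.skeleton = y.skeleton)
    (hxy : (¬ x.Contains (c123 true true true) ∧ ¬ y.Contains (c123 true true true)) ∨
      (¬ x.Contains (c132 true true true) ∧ ¬ y.Contains (c132 true true true))) : x = y := by
  by_contra hne
  have h1 : x.1 ≠ y.1 := fun e => hne (Prod.ext e ((skeleton_eq_iff x y).1 h).1)
  have h2 : ∃ i, x.1 i ≠ y.1 i := by
    by_contra! hc
    exact h1 (Equiv.ext hc)
  obtain ⟨i, hi, hmin⟩ := WellFounded.has_min (wellFounded_lt (α := Fin n)) {i | x.1 i ≠ y.1 i} h2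
  have hmin' : ∀ k < i, x.1 k = y.1 k := fun k hk => by
    by_contra hc
    exact hmin k hc hk
  rcases lt_or_gt_of_ne hi with hlt | hlt
  · have := contains_of_skeleton_eq h hmin' hlt
    tauto
  · have := contains_of_skeleton_eq h.symm (fun k hk => (hmin' k hk).symm) hlt
    tauto

/-- The positive point at `a` lies to the lower left of all four corners of the swap, so none of
them affects the staircase. The swap is its own inverse, so one implication suffices. -/
theorem skeleton_mul_swap (x : ColPerm n) {a b c : Fin n} (hab : a < b) (hbc : b < c)
    (h1 : x.1 a < x.1 b) (h2 : x.1 a < x.1 c) (ha : x.2 a = true) (hb : x.2 b = true)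
    (hc : x.2 c = true) : skeleton (x.1 * Equiv.swap b c, x.2) = x.skeleton := by
  have main : ∀ σ : Equiv.Perm (Fin n), σ a < σ b → σ a < σ c → ∀ i j,
      LowerEmpty (σ, x.2) i j → LowerEmpty (σ * Equiv.swap b c, x.2) i j := by
    intro σ h1 h2 i j h k hk hx
    simp only [Equiv.Perm.mul_apply]
    by_cases hkb : k = b
    · subst hkb
      rw [Equiv.swap_apply_left]
      exact (h a (hab.le.trans hk) ha).trans h2
    · by_cases hkc : k = c
      · subst hkc
        rw [Equiv.swap_apply_right]
        exact (h a ((hab.trans hbc).le.trans hk) ha).trans h1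
      · rw [Equiv.swap_apply_of_ne_of_ne hkb hkc]
        exact h k hk hx
  rw [skeleton_eq_iff]
  refine ⟨rfl, fun i hi => ?_, fun i j => ⟨fun h => ?_, main x.1 h1 h2 i j⟩⟩
  · have h1 : i ≠ b := fun e => by simp [e, hb] at hi
    have h2 : i ≠ c := fun e => by simp [e, hc] at hi
    simp [Equiv.swap_apply_of_ne_of_ne h1 h2]
  · have := main (x.1 * Equiv.swap b c) ?_ ?_ i j h
    · simpa [mul_assoc] using this
    · simpa [Equiv.swap_apply_of_ne_of_ne hab.ne (hab.trans hbc).ne] using h2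
    · simpa [Equiv.swap_apply_of_ne_of_ne hab.ne (hab.trans hbc).ne] using h1

/-- Exchanging the letters `3` and `2` of a positive `132` stays in the fibre and raises the moment;
a maximum therefore avoids the pattern. Dually, a minimum avoids `123`. -/
theorem exists_avoids_c132 (x : ColPerm n) :
    ∃ y : ColPerm n, ¬ y.Contains (c132 true true true) ∧ y.skeleton = x.skeleton := by
  obtain ⟨y, hy, hmax⟩ := Set.exists_max_image {y : ColPerm n | y.skeleton = x.skeleton}
    (fun y => y.1.moment) (Set.toFinite _) ⟨x, rfl⟩
  refine ⟨y, fun hc => ?_, hy⟩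
  rw [contains_c132] at hc
  obtain ⟨a, b, c, hab, hbc, h1, h2, ha, hb, hc⟩ := hc
  have := hmax _ ((skeleton_mul_swap y hab hbc (h1.trans h2) h1 ha hb hc).trans hy)
  exact this.not_gt (y.1.moment_lt_moment_mul_swap hbc h2)

theorem exists_avoids_c123 (x : ColPerm n) :
    ∃ y : ColPerm n, ¬ y.Contains (c123 true true true) ∧ y.skeleton = x.skeleton := by
  obtain ⟨y, hy, hmin⟩ := Set.exists_min_image {y : ColPerm n | y.skeleton = x.skeleton}
    (fun y => y.1.moment) (Set.toFinite _) ⟨x, rfl⟩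
  refine ⟨y, fun hc => ?_, hy⟩
  rw [contains_c123] at hc
  obtain ⟨a, b, c, hab, hbc, h1, h2, ha, hb, hc⟩ := hc
  have h3 := hmin _ ((skeleton_mul_swap y hab hbc h1 (h1.trans h2) ha hb hc).trans hy)
  have h4 := (y.1 * Equiv.swap b c).moment_lt_moment_mul_swap hbc (by simpa using h2)
  simp only [mul_assoc, Equiv.swap_mul_self, mul_one] at h4
  exact h3.not_gt h4

theorem inv_c123 : (c123 true true true).inv = c123 true true true := by decide

theorem inv_c132 : (c132 true true true).inv = c132 true true true := by decide

theorem numAv_c123_eq_c132 (n : ℕ) :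
    (c123 true true true).numAv n = (c132 true true true).numAv n :=
  Nat.card_subtype_eq_of_sections skeleton _ _ (fun x _ => exists_avoids_c132 x)
    (fun x _ => exists_avoids_c123 x) (fun _ _ hx hy h => eq_of_skeleton_eq h (.inl ⟨hx, hy⟩))
    (fun _ _ hx hy h => eq_of_skeleton_eq h (.inr ⟨hx, hy⟩))

/-- The avoider in the fibre of an involution is itself an involution: its inverse avoids the same
self-inverse pattern and has the same skeleton, so uniqueness applies. -/
theorem numInvAv_c123_eq_c132 (n : ℕ) :
    (c123 true true true).numInvAv n = (c132 true true true).numInvAv n := by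
  refine Nat.card_subtype_eq_of_sections skeleton _ _ ?_ ?_
    (fun _ _ hx hy h => eq_of_skeleton_eq h (.inl ⟨hx.2, hy.2⟩))
    (fun _ _ hx hy h => eq_of_skeleton_eq h (.inr ⟨hx.2, hy.2⟩))
  · rintro x ⟨hx, -⟩
    obtain ⟨y, hy, hxy⟩ := exists_avoids_c132 x
    refine ⟨y, ⟨isInvol_of_inv_eq (eq_of_skeleton_eq ?_ (.inr ⟨fun h => hy ?_, hy⟩)), hy⟩, hxy⟩
    · rw [skeleton_inv hxy, hx.inv_eq, hxy]
    · simpa [inv_involutive y, inv_c132] using h.inv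
  · rintro x ⟨hx, -⟩
    obtain ⟨y, hy, hxy⟩ := exists_avoids_c123 x
    refine ⟨y, ⟨isInvol_of_inv_eq (eq_of_skeleton_eq ?_ (.inl ⟨fun h => hy ?_, hy⟩)), hy⟩, hxy⟩
    · rw [skeleton_inv hxy, hx.inv_eq, hxy]
    · simpa [inv_involutive y, inv_c123] using h.inv

end ColPerm

/-! ### Ballot words as counting functions -/

section Ballot

variable {n : ℕ}

/-- Counting functions of ballot words of length `n`, extended by a constant. -/
def BallotPath (n : ℕ) (N : ℕ → ℕ) : Prop :=
  N 0 = 0 ∧ (∀ t, N t ≤ N (t + 1) ∧ N (t + 1) ≤ N t + 1) ∧ (∀ t, 2 * N t ≤ t) ∧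
    ∀ t, n ≤ t → N t = N n

open Classical in
/-- The number of elements below `t` with the property `P`. -/
noncomputable def countBelow (P : Fin n → Prop) (t : ℕ) : ℕ :=
  (Finset.univ.filter fun i : Fin n => (i : ℕ) < t ∧ P i).card

theorem countBelow_zero (P : Fin n → Prop) : countBelow P 0 = 0 := by
  simp [countBelow]

theorem countBelow_succ_of_mem {P : Fin n → Prop} {i : Fin n} (h : P i) :
    countBelow P (i + 1) = countBelow P i + 1 := by
  classical
  unfold countBelow
  rw [← Finset.card_insert_of_notMem (a := i) (by simp)]
  congr 1
  ext j
  simp only [Finset.mem_filter, Finset.mem_univ, true_and, Finset.mem_insert]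
  constructor
  · rintro ⟨h1, h2⟩
    rcases Nat.lt_succ_iff_lt_or_eq.1 h1 with h3 | h3
    · exact .inr ⟨h3, h2⟩
    · exact .inl (Fin.ext h3)
  · rintro (rfl | h1)
    · exact ⟨by omega, h⟩
    · exact ⟨by omega, h1.2⟩

theorem countBelow_succ_of_not {P : Fin n → Prop} {t : ℕ} (h : ∀ i : Fin n, (i : ℕ) = t → ¬ P i) :
    countBelow P (t + 1) = countBelow P t := by
  classical
  unfold countBelow
  congr 1
  ext j
  simp only [Finset.mem_filter, Finset.mem_univ, true_and]
  refine and_congr_left fun hj => ?_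
  have : (j : ℕ) ≠ t := fun e => h j e hj
  omega

theorem countBelow_succ_iff (P : Fin n → Prop) (i : Fin n) :
    countBelow P (i + 1) = countBelow P i + 1 ↔ P i := by
  refine ⟨fun h => ?_, countBelow_succ_of_mem⟩
  by_contra hP
  rw [countBelow_succ_of_not (t := i) fun j hj => by rwa [Fin.ext hj]] at h
  omega

theorem countBelow_step (P : Fin n → Prop) (t : ℕ) :
    countBelow P t ≤ countBelow P (t + 1) ∧ countBelow P (t + 1) ≤ countBelow P t + 1 := by
  by_cases h : ∃ i : Fin n, (i : ℕ) = t ∧ P i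
  · obtain ⟨i, rfl, hi⟩ := h
    rw [countBelow_succ_of_mem hi]
    omega
  · rw [countBelow_succ_of_not fun i hi hP => h ⟨i, hi, hP⟩]
    omega

theorem countBelow_congr {P Q : Fin n → Prop} {t : ℕ} (h : ∀ i : Fin n, (i : ℕ) < t → (P i ↔ Q i)) :
    countBelow P t = countBelow Q t := by
  unfold countBelow
  congr 1
  ext i
  simp only [Finset.mem_filter, Finset.mem_univ, true_and]
  exact and_congr_right (h i)

theorem countBelow_le_of_injective {P Q : Fin n → Prop} {t : ℕ} (f : Fin n → Fin n)
    (hf : Function.Injective f) (h : ∀ i : Fin n, (i : ℕ) < t → P i → (f i : ℕ) < t ∧ Q (f i)) :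
    countBelow P t ≤ countBelow Q t := by
  classical
  refine Finset.card_le_card_of_injOn f (fun i hi => ?_) hf.injOn
  have hi' := (Finset.mem_filter.1 hi).2
  exact Finset.mem_filter.2 ⟨Finset.mem_univ _, h i hi'.1 hi'.2⟩

theorem countBelow_add {P Q : Fin n → Prop} (h : ∀ i, P i → ¬ Q i) (t : ℕ) :
    countBelow P t + countBelow Q t = countBelow (fun i => P i ∨ Q i) t := by
  classical
  unfold countBelow
  rw [← Finset.card_union_of_disjoint]
  · congr 1
    ext i
    simp only [Finset.mem_union, Finset.mem_filter, Finset.mem_univ, true_and]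
    tauto
  · rw [Finset.disjoint_filter]
    exact fun i _ hP hQ => h i hP.2 hQ.2

theorem countBelow_le (P : Fin n → Prop) (t : ℕ) : countBelow P t ≤ t := by
  classical
  refine (Finset.card_le_card_of_injOn (t := Finset.range t) (fun i : Fin n => (i : ℕ))
    (fun i hi => ?_) Fin.val_injective.injOn).trans (Finset.card_range t).le
  exact Finset.mem_range.2 (Finset.mem_filter.1 hi).2.1

theorem countBelow_of_forall {P : Fin n → Prop} {t : ℕ} (ht : t ≤ n)
    (h : ∀ i : Fin n, (i : ℕ) < t → P i) : countBelow P t = t := by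
  induction t with
  | zero => exact countBelow_zero _
  | succ t ih =>
    rw [countBelow_succ_of_mem (i := ⟨t, ht⟩) (h _ (Nat.lt_succ_self t)),
      ih (by omega) fun i hi => h i (by omega)]

/-- The counting function is recovered from its set of rises. Constancy beyond `n` is essential, as
`countBelow` sees only positions below `n`. -/
theorem BallotPath.eq_countBelow {N : ℕ → ℕ} (hN : BallotPath n N) :
    countBelow (fun i : Fin n => N (i + 1) = N i + 1) = N := by
  funext t
  induction t with
  | zero => rw [countBelow_zero, hN.1]
  | succ t ih =>
    have h1 := hN.2.1 t
    by_cases ht : t < n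
    · by_cases h : N (t + 1) = N t + 1
      · have := countBelow_succ_of_mem (P := fun i : Fin n => N (i + 1) = N i + 1) (i := ⟨t, ht⟩) h
        rw [this, h, ih]
      · rw [countBelow_succ_of_not (by rintro i rfl; exact h), ih]
        omega
    · rw [countBelow_succ_of_not (fun i hi => by have := i.isLt; omega), ih,
        hN.2.2.2 t (by omega), hN.2.2.2 (t + 1) (by omega)]

/-- A downward closed set is determined by its number of elements. -/
theorem lt_card_iff_of_lower (P : Fin n → Prop) [DecidablePred P] (hP : ∀ i j, i ≤ j → P j → P i)
    (i : Fin n) : (i : ℕ) < (Finset.univ.filter P).card ↔ P i := by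
  constructor
  · intro h
    by_contra hi
    have : Finset.univ.filter P ⊆ Finset.Iio i := fun j hj => by
      rw [Finset.mem_Iio]
      by_contra hij
      exact hi (hP i j (not_lt.1 hij) (Finset.mem_filter.1 hj).2)
    have := Finset.card_le_card this
    rw [Fin.card_Iio] at this
    omega
  · intro h
    have : Finset.Iic i ⊆ Finset.univ.filter P := fun j hj =>
      Finset.mem_filter.2 ⟨Finset.mem_univ _, hP j i (Finset.mem_Iic.1 hj) h⟩
    have := Finset.card_le_card this
    rw [Fin.card_Iic] at this
    omega

end Ballot

/-! ### Involutions avoiding `321` and ballot words -/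

namespace Equiv.Perm

section Avoidance

variable {α : Type*} [LinearOrder α]

def Avoids321 (w : Equiv.Perm α) : Prop :=
  ∀ i j k, i < j → j < k → ¬ (w k < w j ∧ w j < w i)

def Avoids132 (w : Equiv.Perm α) : Prop :=
  ∀ i j k, i < j → j < k → ¬ (w i < w k ∧ w k < w j)

/-- In an involution, `321` may be taken of the form: a two-cycle over a fixed point or another
two-cycle. -/
theorem exists_nesting {w : Equiv.Perm α} (hw : ∀ i, w (w i) = i) (h : ¬ w.Avoids321) :
    ∃ a x, a < x ∧ x ≤ w x ∧ w x < w a := by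
  unfold Avoids321 at h
  push Not at h
  obtain ⟨i, j, k, hij, hjk, h1, h2⟩ := h
  rcases le_or_gt j (w j) with hj | hj
  · exact ⟨i, j, hij, hj, h2⟩
  -- The middle point lies below the diagonal, so the occurrence is reflected in it.
  · exact ⟨w k, w j, h1, by rw [hw]; exact hj.le, by rwa [hw, hw]⟩

theorem avoids321_of_no_nesting {w : Equiv.Perm α} (hw : ∀ i, w (w i) = i)
    (h : ∀ a x, a < x → x ≤ w x → ¬ w x < w a) : w.Avoids321 := by
  by_contra hc
  obtain ⟨a, x, h1, h2, h3⟩ := exists_nesting hw hc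
  exact h a x h1 h2 h3

end Avoidance

variable {n : ℕ}

/-- Deleting a nesting of an involution by conjugation: the new involution has the same set of
second elements of two-cycles, and a larger moment. -/
theorem unnest {w : Equiv.Perm (Fin n)} (hw : ∀ i, w (w i) = i) {a x : Fin n} (hax : a < x)
    (hx : x ≤ w x) (hxa : w x < w a) :
    ∃ v : Equiv.Perm (Fin n), (∀ i, v (v i) = i) ∧ (∀ i, v i < i ↔ w i < i) ∧
      w.moment < v.moment := by
  let s := Equiv.swap a x
  let v := s * w * s
  have hs : ∀ i, s (s i) = i := fun i => Equiv.swap_apply_self _ _ _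
  have hsa : s a = x := Equiv.swap_apply_left _ _
  have hsx : s x = a := Equiv.swap_apply_right _ _
  have hso : ∀ i, i ≠ a → i ≠ x → s i = i := fun i => Equiv.swap_apply_of_ne_of_ne
  have hv : ∀ i, v i = s (w (s i)) := fun i => rfl
  have hwax : w a ≠ x := fun e => absurd (hx.trans_lt hxa) (by rw [e]; exact lt_irrefl _)
  have hwaa : w a ≠ a := fun e => absurd (hax.trans_le (hx.trans hxa.le)) (by rw [e]; exact lt_irrefl _)
  have hwxa : w x ≠ a := fun e => absurd (hax.trans_le hx) (by rw [e]; exact lt_irrefl _)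
  refine ⟨v, fun i => by simp only [hv, hs, hw], fun i => ?_, ?_⟩
  · rw [hv]
    by_cases hia : i = a
    · subst hia
      rw [hsa]
      have h1 : ¬ w i < i := (hax.trans_le (hx.trans hxa.le)).not_gt
      by_cases hwx : w x = x
      · rw [hwx, hsx]
        exact ⟨fun h => absurd h (lt_irrefl _), fun h => absurd h h1⟩
      · rw [hso _ hwxa hwx]
        exact ⟨fun h => absurd h (hax.trans_le hx).not_gt, fun h => absurd h h1⟩
    · by_cases hix : i = x
      · subst hix
        rw [hsx, hso _ hwaa hwax]
        exact ⟨fun h => absurd h (hx.trans_lt hxa).not_gt, fun h => absurd h hx.not_gt⟩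
      · rw [hso i hia hix]
        by_cases h1 : w i = a
        · have : i = w a := by rw [← h1, hw]
          rw [h1, hsa, this]
          exact ⟨fun _ => hax.trans_le (hx.trans hxa.le), fun _ => hx.trans_lt hxa⟩
        · by_cases h2 : w i = x
          · have : i = w x := by rw [← h2, hw]
            rw [h2, hsx, this]
            exact ⟨fun _ => lt_of_le_of_ne hx fun e => hix (by rw [this, ← e]),
              fun _ => hax.trans_le hx⟩
          · rw [hso _ h1 h2]
  · have h1 : w.moment < (w * s).moment := w.moment_lt_moment_mul_swap hax hxa
    have hsb : s (w a) = w a := hso _ hwaa hwax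
    -- Conjugation by `s` amounts to two successive swaps of positions, each removing an inversion.
    -- If `x` is fixed by `w`, the second swap involves position `s x = a`.
    have h2 : v = (w * s) * Equiv.swap (s (w x)) (w a) := by
      have e : (w * s).symm a = w a := by
        rw [Equiv.symm_apply_eq, Equiv.Perm.mul_apply, hsb, hw]
      have e' : (w * s).symm x = s (w x) := by
        rw [Equiv.symm_apply_eq, Equiv.Perm.mul_apply, hs, hw]
      rw [← e, ← e', Equiv.swap_comm]
      exact Equiv.swap_mul_eq_mul_swap (w * s) a x
    rw [h2]
    refine h1.trans (moment_lt_moment_mul_swap _ ?_ ?_)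
    · by_cases hwx : w x = x
      · rw [hwx, hsx]
        exact hax.trans_le (hx.trans hxa.le)
      · rwa [hso _ hwxa hwx]
    · simp only [Equiv.Perm.mul_apply, hs, hw, hsb]
      exact hax

/-- Every ballot word is the word of second elements of two-cycles of some involution. -/
theorem exists_involution_of_ballotPath {N : ℕ → ℕ} (hN : BallotPath n N) :
    ∀ t ≤ n, ∃ w : Equiv.Perm (Fin n), (∀ i, w (w i) = i) ∧ (∀ i : Fin n, t ≤ i → w i = i) ∧
      ∀ i : Fin n, (i : ℕ) < t → (w i < i ↔ N (i + 1) = N i + 1) := by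
  classical
  intro t
  induction t with
  | zero => exact fun _ => ⟨1, fun _ => rfl, fun _ _ => rfl, fun i hi => absurd hi (by omega)⟩
  | succ t ih =>
    intro ht
    obtain ⟨w, h1, h2, h3⟩ := ih (by omega)
    by_cases hC : N (t + 1) = N t + 1
    -- A new closer needs an unmatched earlier point. Without one, positions below `t` are openers
    -- or closers, and openers inject into closers, so `t ≤ 2 * N t`, against the ballot condition
    -- at `t + 1`.
    · have hfix : ∃ x : Fin n, (x : ℕ) < t ∧ w x = x := by
        by_contra! hno
        have hlt : ∀ i : Fin n, (i : ℕ) < t → (w i : ℕ) < t := fun i hi => by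
          by_contra! hc
          have := h2 _ hc
          rw [h1] at this
          rw [← this] at hc
          omega
        have e1 : countBelow (fun i => w i < i) t = N t := by
          conv_rhs => rw [← hN.eq_countBelow]
          exact countBelow_congr h3
        have e2 : countBelow (fun i => i < w i) t ≤ countBelow (fun i => w i < i) t :=
          countBelow_le_of_injective w w.injective fun i hi h => ⟨hlt i hi, by rwa [h1]⟩
        have e3 : countBelow (fun i => i < w i) t + countBelow (fun i => w i < i) t = t := by
          rw [countBelow_add fun i h => h.not_gt]
          exact countBelow_of_forall (by omega) fun i hi => lt_or_gt_of_ne (hno i hi).symm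
        have := hN.2.2.1 (t + 1)
        omega
      obtain ⟨x, hx, hwx⟩ := hfix
      let T : Fin n := ⟨t, ht⟩
      have hwT : w T = T := h2 T le_rfl
      have hxT : x < T := hx
      have ho : ∀ i, i ≠ x → i ≠ T → (w * Equiv.swap x T) i = w i := fun i hi hi' => by
        simp [Equiv.swap_apply_of_ne_of_ne hi hi']
      have hx' : (w * Equiv.swap x T) x = T := by simp [hwT]
      have hT' : (w * Equiv.swap x T) T = x := by simp [hwx]
      refine ⟨w * Equiv.swap x T, fun i => ?_, fun i hi => ?_, fun i hi => ?_⟩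
      · by_cases hix : i = x
        · rw [hix, hx', hT']
        · by_cases hiT : i = T
          · rw [hiT, hT', hx']
          · rw [ho i hix hiT, ho _ _ _, h1]
            · exact fun e => hix (by rw [← h1 i, e, hwx])
            · exact fun e => hiT (by rw [← h1 i, e, hwT])
      · rw [ho i, h2 i (by omega)]
        · rintro rfl; omega
        · rintro rfl; simp [T] at hi
      · by_cases hix : i = x
        · rw [hix, hx', ← h3 x hx, hwx]
          simp [hxT.le]
        · by_cases hiT : i = T
          · rw [hiT, hT']
            simp [hxT, T, hC]
          · rw [ho i hix hiT, h3 i]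
            have : (i : ℕ) ≠ t := fun e => hiT (Fin.ext e)
            omega
    · refine ⟨w, h1, fun i hi => h2 i (by omega), fun i hi => ?_⟩
      rcases Nat.lt_succ_iff_lt_or_eq.1 hi with h | h
      · exact h3 i h
      · subst h
        rw [h2 i le_rfl]
        simp [hC]

/-- Among the involutions with the prescribed closers, one of maximal moment has no nesting left to
remove. -/
theorem exists_avoids321_of_ballotPath {N : ℕ → ℕ} (hN : BallotPath n N) :
    ∃ w : Equiv.Perm (Fin n), ((∀ i, w (w i) = i) ∧ w.Avoids321) ∧
      countBelow (fun i => w i < i) = N := by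
  obtain ⟨w₀, h1, -, h2⟩ := exists_involution_of_ballotPath hN n le_rfl
  obtain ⟨w, ⟨hw, hwN⟩, hmax⟩ := Set.exists_max_image
    {w : Equiv.Perm (Fin n) | (∀ i, w (w i) = i) ∧ ∀ i : Fin n, w i < i ↔ N (i + 1) = N i + 1}
    moment (Set.toFinite _) ⟨w₀, h1, fun i => h2 i i.isLt⟩
  refine ⟨w, ⟨hw, avoids321_of_no_nesting hw fun a x hax hx hxa => ?_⟩, ?_⟩
  · obtain ⟨v, hv1, hv2, hv3⟩ := unnest hw hax hx hxa
    exact (hmax v ⟨hv1, fun i => (hv2 i).trans (hwN i)⟩).not_gt hv3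
  · rw [← hN.eq_countBelow]
    simp only [hwN]

/-- Each closer is preceded by its own partner, which is an opener; this gives the ballot
inequality. -/
theorem ballotPath_closers {w : Equiv.Perm (Fin n)} (hw : ∀ i, w (w i) = i) :
    BallotPath n (countBelow fun i => w i < i) := by
  classical
  refine ⟨countBelow_zero _, countBelow_step _, fun t => ?_, fun t ht => ?_⟩
  · have e : countBelow (fun i => w i < i) t ≤ countBelow (fun i => i < w i) t :=
      countBelow_le_of_injective w w.injective fun i hi h => ⟨lt_trans h hi, by rwa [hw]⟩
    have e' := countBelow_le (fun i => i < w i ∨ w i < i) t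
    rw [← countBelow_add fun i h => h.not_gt] at e'
    omega
  · unfold countBelow
    congr 1
    ext i
    have := i.isLt
    simp only [Finset.mem_filter, Finset.mem_univ, true_and]
    refine and_congr_left fun _ => ⟨fun _ => this, fun _ => by omega⟩

/-- Consider the largest disagreement `i`. If it is not a closer, it is fixed by both involutions.
If it is one and `w i < v i`, then `v i` is not a closer and `w (v i) < i`, so positions `w i`, `v
i`, `i` form a `321` in `w`. -/
theorem eq_of_closers_eq {w v : Equiv.Perm (Fin n)} (hw : ∀ i, w (w i) = i)
    (hv : ∀ i, v (v i) = i) (hwa : w.Avoids321) (hva : v.Avoids321)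
    (h : ∀ i, w i < i ↔ v i < i) : w = v := by
  by_contra hne
  have h2 : ∃ i, w i ≠ v i := by
    by_contra! hc
    exact hne (Equiv.ext hc)
  obtain ⟨i, hi, hmax⟩ := WellFounded.has_min (wellFounded_gt (α := Fin n)) {i | w i ≠ v i} h2
  have hmax' : ∀ k, i < k → w k = v k := fun k hk => by
    by_contra hc
    exact hmax k hc hk
  have fix : ∀ {w v : Equiv.Perm (Fin n)}, (∀ i, w (w i) = i) → (∀ i, v (v i) = i) →
      (∀ k, i < k → w k = v k) → ¬ w i < i → w i ≠ v i → w i = i := by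
    intro w v hw hv hk h1 h2
    by_contra h3
    have h4 := hk (w i) (lt_of_le_of_ne (not_lt.1 h1) (Ne.symm h3))
    rw [hw] at h4
    exact h2 (by conv_rhs => rw [h4, hv])
  have nest : ∀ {w v : Equiv.Perm (Fin n)}, (∀ i, w (w i) = i) → (∀ i, v (v i) = i) →
      (∀ k, i < k → w k = v k) → (∀ i, w i < i ↔ v i < i) → w.Avoids321 → v i < i →
      ¬ w i < v i := by
    intro w v hw hv hk h ha hvi hlt
    have h1 : v i ≤ w (v i) := by
      rw [← not_lt, h, hv]
      exact hvi.not_gt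
    have h2 : w (v i) < i := by
      by_contra hc
      rcases (not_lt.1 hc).lt_or_eq with h3 | h3
      · have := hk _ h3
        rw [hw, eq_comm, ← Equiv.eq_symm_apply] at this
        rw [show v.symm = v from Equiv.ext fun j => by rw [Equiv.symm_apply_eq, hv], hv] at this
        exact h3.ne this.symm
      · have : w i = v i := by
          conv_lhs => rw [h3]
          exact hw _
        exact hlt.ne this
    exact ha (w i) (v i) (i) hlt hvi ⟨by omega, by rwa [hw]⟩
  by_cases hc : w i < i
  · rcases lt_or_gt_of_ne hi with hlt | hlt
    · exact nest hw hv hmax' h hwa ((h i).1 hc) hlt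
    · exact nest hv hw (fun k hk => (hmax' k hk).symm) (fun j => (h j).symm) hva hc hlt
  · have e1 := fix hw hv hmax' hc hi
    have e2 := fix hv hw (fun k hk => (hmax' k hk).symm) (by rwa [← h]) hi.symm
    exact hi (e1.trans e2.symm)

theorem card_involutions_avoids321 (n : ℕ) :
    Nat.card {w : Equiv.Perm (Fin n) // (∀ i, w (w i) = i) ∧ w.Avoids321} =
      Nat.card {N : ℕ → ℕ // BallotPath n N} := by
  refine Nat.card_eq_of_bijective (fun w => ⟨_, ballotPath_closers w.2.1⟩) ⟨?_, ?_⟩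
  · intro w v h
    have h' : countBelow (fun i => w.1 i < i) = countBelow (fun i => v.1 i < i) :=
      congrArg Subtype.val h
    refine Subtype.ext (eq_of_closers_eq w.2.1 v.2.1 w.2.2 v.2.2 fun i => ?_)
    rw [← countBelow_succ_iff (fun i => w.1 i < i), h', countBelow_succ_iff]
  · rintro ⟨N, hN⟩
    obtain ⟨w, hw, h⟩ := exists_avoids321_of_ballotPath hN
    exact ⟨⟨w, hw⟩, Subtype.ext h⟩

end Equiv.Perm

/-! ### Involutions avoiding `132` and symmetric staircases -/

namespace Equiv.Perm

variable {n : ℕ}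

/-- A permutation regarded as a signed permutation without negative letters. -/
def allPositive (w : Equiv.Perm (Fin n)) : ColPerm n := (w, fun _ => true)

theorem allPositive_contains_c132 (w : Equiv.Perm (Fin n)) :
    ¬ w.allPositive.Contains (ColPerm.c132 true true true) ↔ w.Avoids132 := by
  rw [ColPerm.contains_c132]
  unfold Avoids132 allPositive
  push Not
  exact ⟨fun h i j k h1 h2 h3 => not_lt.1 fun h4 => h i j k h1 h2 h3 h4 rfl rfl rfl,
    fun h i j k h1 h2 h3 h4 => absurd h4 (not_lt.2 (h i j k h1 h2 h3))⟩

theorem eq_of_lowerEmpty_iff {w v : Equiv.Perm (Fin n)} (hw : w.Avoids132) (hv : v.Avoids132)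
    (h : ∀ i j, w.allPositive.LowerEmpty i j ↔ v.allPositive.LowerEmpty i j) : w = v :=
  congrArg Prod.fst (ColPerm.eq_of_skeleton_eq (x := w.allPositive) (y := v.allPositive)
    ((ColPerm.skeleton_eq_iff _ _).2 ⟨rfl, fun _ h => by simp [allPositive] at h, h⟩)
    (.inr ⟨w.allPositive_contains_c132.2 hw, v.allPositive_contains_c132.2 hv⟩))

theorem avoids132_symm {w : Equiv.Perm (Fin n)} (hw : w.Avoids132) : Avoids132 w.symm := by
  rw [← allPositive_contains_c132] at hw ⊢
  intro h
  apply hw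
  have := h.inv
  rw [ColPerm.inv_c132] at this
  exact this

theorem lowerEmpty_symm (w : Equiv.Perm (Fin n)) (i j : Fin n) :
    (allPositive w.symm).LowerEmpty i j ↔ w.allPositive.LowerEmpty j i :=
  ColPerm.inv_lowerEmpty w.allPositive i j

theorem lowerEmpty_iff (w : Equiv.Perm (Fin n)) (i j : Fin n) :
    w.allPositive.LowerEmpty i j ↔ ∀ k ≤ i, j < w k := by
  simp [ColPerm.LowerEmpty, allPositive]

/-- A staircase below the antidiagonal is the region below the left-to-right minima of some
`132`-avoiding permutation. -/
theorem exists_avoids132 (Λ : Fin n → Fin n → Prop)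
    (hΛ : ∀ i j i' j', Λ i j → i' ≤ i → j' ≤ j → Λ i' j') (hrev : ∀ i : Fin n, ¬ Λ i i.rev) :
    ∃ w : Equiv.Perm (Fin n), w.Avoids132 ∧ ∀ i j, w.allPositive.LowerEmpty i j ↔ Λ i j := by
  obtain ⟨w, hw, hmax⟩ := Set.exists_max_image {w : Equiv.Perm (Fin n) | ∀ i, ¬ Λ i (w i)}
    moment (Set.toFinite _) ⟨Fin.revPerm, hrev⟩
  have hw' : ∀ i, ¬ Λ i (w i) := hw
  -- The swap would raise the moment, so by maximality it must put a point into `Λ`. The upper right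
  -- corner dominates a point of `w` and stays outside, so the lower left corner is in `Λ`.
  have swap : ∀ i k, i < k → w k < w i → Λ i (w k) := by
    intro i k hik hlt
    by_contra hc
    refine (hmax (w * Equiv.swap i k) fun x => ?_).not_gt (w.moment_lt_moment_mul_swap hik hlt)
    simp only [Equiv.Perm.mul_apply]
    by_cases h1 : x = i
    · rwa [h1, Equiv.swap_apply_left]
    · by_cases h2 : x = k
      · rw [h2, Equiv.swap_apply_right]
        exact fun h => hw' i (hΛ _ _ _ _ h hik.le le_rfl)
      · rw [Equiv.swap_apply_of_ne_of_ne h1 h2]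
        exact hw' x
  refine ⟨w, fun i j k hij hjk h => ?_, fun i j => ?_⟩
  · exact hw' i (hΛ _ _ _ _ (swap j k hjk h.2) hij.le h.1.le)
  · rw [lowerEmpty_iff]
    constructor
    · intro h
      have hk : i < w.symm j := by
        by_contra hc
        simpa using h _ (not_lt.1 hc)
      simpa using swap i _ hk (by simpa using h i le_rfl)
    · intro h k hk
      by_contra hc
      exact hw' k (hΛ _ _ _ _ h hk (not_lt.1 hc))

/-- The word of a symmetric staircase, read off the diagonals. -/
noncomputable def diagonalCount (w : Equiv.Perm (Fin n)) (t : ℕ) : ℕ :=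
  (Finset.univ.filter fun i : Fin n => ∀ k ≤ i, (i : ℕ) + n < w k + min t n).card

/-- For `t ≤ n`, the part of the staircase on the diagonal `j - i = n - t` is an initial segment,
and `diagonalCount` is its length. The additive form avoids truncated subtraction, and it fails off
the board because `w k < n`. -/
theorem lt_diagonalCount_iff (w : Equiv.Perm (Fin n)) (t : ℕ) (i : Fin n) :
    (i : ℕ) < w.diagonalCount t ↔ ∀ k ≤ i, (i : ℕ) + n < w k + min t n := by
  refine lt_card_iff_of_lower _ (fun i j hij h k hk => ?_) i
  have := h k (hk.trans hij)
  omega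

theorem diagonalCount_le (w : Equiv.Perm (Fin n)) (t : ℕ) : w.diagonalCount t ≤ n :=
  (Finset.card_le_univ _).trans (Fintype.card_fin n).le

/-- Passing to the next diagonal moves a cell down by one, or left by one after shifting the index,
so lengths grow by zero or one. A segment of length `d` forces the first `d` values above `d - 1 + n
- t`, and only `t - d` such values exist, so `2 * d ≤ t`. -/
theorem ballotPath_diagonalCount (w : Equiv.Perm (Fin n)) : BallotPath n w.diagonalCount := by
  have hle := w.diagonalCount_le
  have ball : ∀ t, 2 * w.diagonalCount t ≤ t := by
    intro t
    by_contra! hc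
    have h0 := hle t
    have h1 := (w.lt_diagonalCount_iff t ⟨w.diagonalCount t - 1, by omega⟩).1
      (by simp only; omega)
    have h2 := Finset.card_le_card_of_injOn
      (s := Finset.Iic (⟨w.diagonalCount t - 1, by omega⟩ : Fin n))
      (t := Finset.Ioo (w.diagonalCount t - 1 + n - min t n) n) (fun k => ((w k : Fin n) : ℕ))
      (fun k hk => by
        have h3 := h1 k (by simpa using hk)
        simp only [Finset.coe_Ioo, Set.mem_Ioo]
        simp only at h3
        have := (w k).isLt
        omega)
      (Fin.val_injective.comp w.injective).injOn
    rw [Fin.card_Iic, Nat.card_Ioo] at h2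
    simp only at h2
    omega
  refine ⟨by have := ball 0; omega, fun t => ⟨?_, ?_⟩, ball, fun t ht => ?_⟩
  · by_contra! hc
    have h0 := hle t
    have h1 := (w.lt_diagonalCount_iff t ⟨w.diagonalCount (t + 1), by omega⟩).1 hc
    exact lt_irrefl _ ((w.lt_diagonalCount_iff (t + 1) ⟨w.diagonalCount (t + 1), by omega⟩).2
      fun k hk => by have := h1 k hk; omega)
  · by_contra! hc
    have h0 := hle (t + 1)
    have h1 := (w.lt_diagonalCount_iff (t + 1) ⟨w.diagonalCount t + 1, by omega⟩).1 hc
    refine lt_irrefl _ ((w.lt_diagonalCount_iff t ⟨w.diagonalCount t, by omega⟩).2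
      fun k hk => ?_)
    have := h1 k (hk.trans (by simp [Fin.le_def]))
    simp only at this ⊢
    omega
  · simp [diagonalCount, ht]

/-- The word thus determines the half of the staircase with `i ≤ j`, and for an involution the other
half by symmetry. -/
theorem lowerEmpty_iff_lt_diagonalCount (w : Equiv.Perm (Fin n)) {i j : Fin n} (hij : i ≤ j) :
    w.allPositive.LowerEmpty i j ↔ (i : ℕ) < w.diagonalCount (n + i - j) := by
  rw [lowerEmpty_iff, lt_diagonalCount_iff]
  have := j.isLt
  refine forall₂_congr fun k _ => ?_
  rw [Fin.lt_def]
  rw [Fin.le_def] at hij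
  omega

theorem lowerEmpty_comm {w : Equiv.Perm (Fin n)} (hw : ∀ i, w (w i) = i) (i j : Fin n) :
    w.allPositive.LowerEmpty i j ↔ w.allPositive.LowerEmpty j i := by
  rw [← lowerEmpty_symm, show w.symm = w from Equiv.ext fun j => by rw [Equiv.symm_apply_eq, hw]]

theorem exists_avoids132_of_ballotPath {N : ℕ → ℕ} (hN : BallotPath n N) :
    ∃ w : Equiv.Perm (Fin n), ((∀ i, w (w i) = i) ∧ w.Avoids132) ∧ w.diagonalCount = N := by
  obtain ⟨-, hstep, hball, hconst⟩ := hN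
  have hmono : Monotone N := monotone_nat_of_le_succ fun t => (hstep t).1
  have hlip : ∀ t d, N (t + d) ≤ N t + d := by
    intro t d
    induction d with
    | zero => simp
    | succ d ih =>
      have := (hstep (t + d)).2
      rw [← add_assoc]
      omega
  -- The cell `(i, j)` with `i ≤ j` is the one of index `i` on the diagonal numbered `n + i - j`;
  -- taking minimum and maximum symmetrises this.
  let Λ : Fin n → Fin n → Prop := fun i j =>
    min (i : ℕ) j < N (n + min (i : ℕ) j - max (i : ℕ) j)
  have hsymm : ∀ i j, Λ i j ↔ Λ j i := fun i j => by
    simp only [Λ, min_comm, max_comm]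
  have hlower : ∀ i j i' j', Λ i j → i' ≤ i → j' ≤ j → Λ i' j' := by
    intro i j i' j' h hi hj
    simp only [Λ] at h ⊢
    rw [Fin.le_def] at hi hj
    have := i.isLt
    have := j.isLt
    generalize hm : min (i : ℕ) j = m at *
    generalize hM : max (i : ℕ) j = M at *
    generalize hm' : min (i' : ℕ) j' = m' at *
    generalize hM' : max (i' : ℕ) j' = M' at *
    -- Decreasing the smaller coordinate by `d` lowers the diagonal number by at most `d`, hence `N`
    -- by at most `d`; decreasing the larger one only raises the number.
    have h1 := hmono (show n + m - M ≤ n + m' - M' + (m - m') by omega)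
    have h2 := hlip (n + m' - M') (m - m')
    omega
  have hrev : ∀ i : Fin n, ¬ Λ i i.rev := by
    intro i h
    simp only [Λ, Fin.val_rev] at h
    have := i.isLt
    -- On the antidiagonal the coordinates add up to `n - 1`, so this argument is twice the minimum
    -- plus one.
    have := hball (n + min (i : ℕ) (n - (i + 1)) - max (i : ℕ) (n - (i + 1)))
    omega
  obtain ⟨w, hw, hΛ⟩ := exists_avoids132 Λ hlower hrev
  have hinv : w.symm = w := eq_of_lowerEmpty_iff (avoids132_symm hw) hw fun i j => by
    rw [lowerEmpty_symm, hΛ, hΛ, hsymm]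
  have hww : ∀ i, w (w i) = i := fun i => by rw [← Equiv.eq_symm_apply, hinv]
  refine ⟨w, ⟨hww, hw⟩, ?_⟩
  have key : ∀ t ≤ n, w.diagonalCount t = N t := by
    intro t ht
    have h1 := w.diagonalCount_le t
    have h2 := hball t
    have h3 : ∀ i : Fin n, (i : ℕ) < w.diagonalCount t ↔ (i : ℕ) < N t := by
      intro i
      have hi := i.isLt
      by_cases hj : i + n - t < n
      · have h4 := w.lowerEmpty_iff_lt_diagonalCount (i := i) (j := ⟨i + n - t, hj⟩)
          (by rw [Fin.le_def]; simp only; omega)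
        rw [hΛ] at h4
        simp only [Λ] at h4
        rw [min_eq_left (by omega), max_eq_right (by omega),
          show n + (i : ℕ) - (i + n - t) = t by omega] at h4
        exact h4.symm
      -- Here `t ≤ i`, so the cell is off the board, and the ballot bounds make both sides false.
      · have h5 := w.ballotPath_diagonalCount.2.2.1 t
        omega
    by_contra hne
    rcases lt_or_gt_of_ne hne with h | h
    · exact lt_irrefl _ ((h3 ⟨w.diagonalCount t, by omega⟩).2 h)
    · exact lt_irrefl _ ((h3 ⟨N t, by omega⟩).1 h)
  funext t
  by_cases ht : t ≤ n
  · exact key t ht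
  · rw [w.ballotPath_diagonalCount.2.2.2 t (by omega), hconst t (by omega), key n le_rfl]

theorem card_involutions_avoids132 (n : ℕ) :
    Nat.card {w : Equiv.Perm (Fin n) // (∀ i, w (w i) = i) ∧ w.Avoids132} =
      Nat.card {N : ℕ → ℕ // BallotPath n N} := by
  refine Nat.card_eq_of_bijective (fun w => ⟨_, w.1.ballotPath_diagonalCount⟩) ⟨?_, ?_⟩
  · intro w v h
    have h' : w.1.diagonalCount = v.1.diagonalCount := congrArg Subtype.val h
    refine Subtype.ext (eq_of_lowerEmpty_iff w.2.2 v.2.2 fun i j => ?_)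
    rcases le_total i j with hij | hij
    · rw [lowerEmpty_iff_lt_diagonalCount _ hij, lowerEmpty_iff_lt_diagonalCount _ hij, h']
    · rw [lowerEmpty_comm w.2.1, lowerEmpty_comm v.2.1, lowerEmpty_iff_lt_diagonalCount _ hij,
        lowerEmpty_iff_lt_diagonalCount _ hij, h']
  · rintro ⟨N, hN⟩
    obtain ⟨w, hw, h⟩ := exists_avoids132_of_ballotPath hN
    exact ⟨⟨w, hw⟩, Subtype.ext h⟩

theorem card_involutions_avoids_of_orderIso {α : Type*} [LinearOrder α] (e : Fin n ≃o α) :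
    Nat.card {w : Equiv.Perm α // (∀ i, w (w i) = i) ∧ w.Avoids321} =
      Nat.card {w : Equiv.Perm α // (∀ i, w (w i) = i) ∧ w.Avoids132} := by
  have h1 : ∀ w : Equiv.Perm (Fin n), (∀ i, w (w i) = i) ↔
      ∀ i, e.toEquiv.permCongr w (e.toEquiv.permCongr w i) = i := fun w => by
    rw [← e.toEquiv.forall_congr_right]
    simp [Equiv.permCongr_apply]
  have h2 : ∀ w : Equiv.Perm (Fin n), w.Avoids321 ↔ (e.toEquiv.permCongr w).Avoids321 := fun w => by
    unfold Avoids321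
    simp only [← e.toEquiv.forall_congr_right (β := α)]
    simp [Equiv.permCongr_apply]
  have h3 : ∀ w : Equiv.Perm (Fin n), w.Avoids132 ↔ (e.toEquiv.permCongr w).Avoids132 := fun w => by
    unfold Avoids132
    simp only [← e.toEquiv.forall_congr_right (β := α)]
    simp [Equiv.permCongr_apply]
  rw [← Nat.card_congr (e.toEquiv.permCongr.subtypeEquiv fun w => and_congr (h1 w) (h2 w)),
    ← Nat.card_congr (e.toEquiv.permCongr.subtypeEquiv fun w => and_congr (h1 w) (h3 w)),
    card_involutions_avoids321, card_involutions_avoids132]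

theorem card_involutions_avoids321_eq_avoids132 (α : Type*) [LinearOrder α] [Fintype α] :
    Nat.card {w : Equiv.Perm α // (∀ i, w (w i) = i) ∧ w.Avoids321} =
      Nat.card {w : Equiv.Perm α // (∀ i, w (w i) = i) ∧ w.Avoids132} :=
  card_involutions_avoids_of_orderIso (Fintype.orderIsoFinOfCardEq α rfl)

end Equiv.Perm

/-! ### Splitting an involution by sign -/

namespace ColPerm

variable {n : ℕ}

/-- A permutation preserving a sign vector is a pair of permutations, of the positive and of the
negative positions. -/
def restrictEquiv (s : Fin n → Bool) :
    {σ : Equiv.Perm (Fin n) // ∀ i, s (σ i) = s i} ≃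
      Equiv.Perm {i // s i = true} × Equiv.Perm {i // ¬ s i = true} where
  toFun σ := (σ.1.subtypePerm fun i => by rw [σ.2], σ.1.subtypePerm fun i => by rw [σ.2])
  invFun τ := ⟨Equiv.Perm.subtypeCongr τ.1 τ.2, fun i => by
    by_cases h : s i = true
    · rw [Equiv.Perm.subtypeCongr.left_apply (p := fun i => s i = true) _ _ h, h, (τ.1 ⟨i, h⟩).2]
    · rw [Equiv.Perm.subtypeCongr.right_apply (p := fun i => s i = true) _ _ h]
      exact Bool.eq_iff_iff.2 (iff_of_false (τ.2 ⟨i, h⟩).2 h)⟩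
  left_inv σ := by
    refine Subtype.ext (Equiv.ext fun i => ?_)
    by_cases h : s i = true
    · simp [Equiv.Perm.subtypeCongr.left_apply (p := fun i => s i = true) _ _ h]
    · simp [Equiv.Perm.subtypeCongr.right_apply (p := fun i => s i = true) _ _ h]
  right_inv τ := by
    refine Prod.ext (Equiv.ext fun i => Subtype.ext ?_) (Equiv.ext fun i => Subtype.ext ?_)
    · simp [Equiv.Perm.subtypeCongr.left_apply (p := fun i => s i = true) _ _ i.2]
    · simp [Equiv.Perm.subtypeCongr.right_apply (p := fun i => s i = true) _ _ i.2]

/-- Signs are constant on the cycles of a signed involution, so it splits into involutions of its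
positive and negative positions. The hypothesis says that avoidance constrains only the positive
one. -/
theorem numInvAv_eq_card_sigma (p : ColPerm 3)
    (Q : ∀ s : Fin n → Bool, Equiv.Perm {i // s i = true} → Prop)
    (hQ : ∀ (σ : Equiv.Perm (Fin n)) (s : Fin n → Bool) (h : ∀ i, s (σ i) = s i),
      ¬ Contains (σ, s) p ↔ Q s (restrictEquiv s ⟨σ, h⟩).1) :
    p.numInvAv n = Nat.card (Σ s : Fin n → Bool,
      {w : Equiv.Perm {i // s i = true} // (∀ i, w (w i) = i) ∧ Q s w} ×
        {w : Equiv.Perm {i // ¬ s i = true} // ∀ i, w (w i) = i}) := by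
  have e : {x : ColPerm n // x.IsInvol ∧ ¬ x.Contains p} ≃ Σ s : Fin n → Bool,
      {σ : {σ : Equiv.Perm (Fin n) // ∀ i, s (σ i) = s i} //
        (∀ i, σ.1 (σ.1 i) = i) ∧ ¬ Contains (σ.1, s) p} :=
    { toFun := fun x => ⟨x.1.2, ⟨x.1.1, x.2.1.2⟩, x.2.1.1, x.2.2⟩
      invFun := fun y => ⟨(y.2.1.1, y.1), ⟨y.2.2.1, y.2.1.2⟩, y.2.2.2⟩
      left_inv := fun _ => rfl
      right_inv := fun _ => rfl }
  refine Nat.card_congr (e.trans (Equiv.sigmaCongrRight fun s => ?_))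
  refine ((restrictEquiv s).subtypeEquiv
    (q := fun τ => ((∀ i, τ.1 (τ.1 i) = i) ∧ Q s τ.1) ∧ ∀ i, τ.2 (τ.2 i) = i)
    fun σ => ?_).trans (Equiv.subtypeProdEquivProd
      (p := fun w : Equiv.Perm {i // s i = true} => (∀ i, w (w i) = i) ∧ Q s w)
      (q := fun w : Equiv.Perm {i // ¬ s i = true} => ∀ i, w (w i) = i))
  rw [hQ σ.1 s σ.2]
  have : (∀ i, σ.1 (σ.1 i) = i) ↔ (∀ i, (restrictEquiv s σ).1 ((restrictEquiv s σ).1 i) = i) ∧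
      ∀ i, (restrictEquiv s σ).2 ((restrictEquiv s σ).2 i) = i := by
    simp only [restrictEquiv, Equiv.coe_fn_mk, Subtype.ext_iff, Equiv.Perm.subtypePerm_apply,
      Subtype.forall]
    constructor
    · exact fun h => ⟨fun i _ => h i, fun i _ => h i⟩
    · intro h i
      by_cases hi : s i = true
      · exact h.1 i hi
      · exact h.2 i hi
  rw [this]
  tauto

theorem numInvAv_c321_eq_c132 (n : ℕ) :
    (c321 true true true).numInvAv n = (c132 true true true).numInvAv n := by
  rw [numInvAv_eq_card_sigma (c321 true true true) (fun _ w => w.Avoids321),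
    numInvAv_eq_card_sigma (c132 true true true) (fun _ w => w.Avoids132)]
  · simp only [Nat.card_sigma, Nat.card_prod, Equiv.Perm.card_involutions_avoids321_eq_avoids132]
  · intro σ s h
    rw [contains_c132]
    simp only [Equiv.Perm.Avoids132, restrictEquiv, Equiv.coe_fn_mk, Subtype.forall,
      Equiv.Perm.subtypePerm_apply, Subtype.mk_lt_mk]
    push Not
    grind
  · intro σ s h
    rw [contains_c321]
    simp only [Equiv.Perm.Avoids321, restrictEquiv, Equiv.coe_fn_mk, Subtype.forall,
      Equiv.Perm.subtypePerm_apply, Subtype.mk_lt_mk]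
    push Not
    grind

end ColPerm

/-! ### Exact counts at `n = 5` -/

namespace ColPerm

/-- Whether the letters in positions `i`, `j`, `k` form the pattern `p`. -/
def occursAt (x : ColPerm 5) (p : ColPerm 3) (i j k : Fin 5) : Bool :=
  (x.2 i == p.2 0) && ((x.2 j == p.2 1) && ((x.2 k == p.2 2) &&
    (((x.1 i).val.blt (x.1 j) == (p.1 0).val.blt (p.1 1)) &&
    (((x.1 i).val.blt (x.1 k) == (p.1 0).val.blt (p.1 2)) &&
    ((x.1 j).val.blt (x.1 k) == (p.1 1).val.blt (p.1 2))))))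

/-- A decision procedure, fast in the kernel, for containment of a pattern of length three. -/
def occurs (x : ColPerm 5) (p : ColPerm 3) : Bool :=
  x.occursAt p 0 1 2 || (x.occursAt p 0 1 3 || (x.occursAt p 0 1 4 || (x.occursAt p 0 2 3 ||
  (x.occursAt p 0 2 4 || (x.occursAt p 0 3 4 || (x.occursAt p 1 2 3 || (x.occursAt p 1 2 4 ||
  (x.occursAt p 1 3 4 || x.occursAt p 2 3 4))))))))

theorem occurs_iff (x : ColPerm 5) (p : ColPerm 3) : x.occurs p = true ↔ x.Contains p := by
  have h : ∀ i j k, x.occursAt p i j k = true ↔ (x.1 i < x.1 j ↔ p.1 0 < p.1 1) ∧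
      (x.1 i < x.1 k ↔ p.1 0 < p.1 2) ∧ (x.1 j < x.1 k ↔ p.1 1 < p.1 2) ∧
      x.2 i = p.2 0 ∧ x.2 j = p.2 1 ∧ x.2 k = p.2 2 := by
    intro i j k
    have hb : ∀ a b c d : ℕ, Nat.blt a b = Nat.blt c d ↔ (a < b ↔ c < d) := fun a b c d => by
      rw [Bool.eq_iff_iff, Nat.blt_eq, Nat.blt_eq]
    simp only [occursAt, Bool.and_eq_true, beq_iff_eq, hb, Fin.val_fin_lt]
    tauto
  rw [contains_three]
  simp only [← h, occurs, Bool.or_eq_true]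
  constructor
  · rintro (h | h | h | h | h | h | h | h | h | h) <;>
      exact ⟨_, _, _, by decide, by decide, h⟩
  · rintro ⟨i, j, k, hij, hjk, h⟩
    fin_cases i <;> fin_cases j <;> first
      | exact absurd hij (by decide)
      | (fin_cases k <;> first
        | exact absurd hjk (by decide)
        | (simp only [Fin.mk_zero, Fin.mk_one, Fin.reduceFinMk] at h; simp [h]))

theorem numAv_five (p : ColPerm 3) :
    p.numAv 5 = (Finset.univ.filter fun x : ColPerm 5 => x.occurs p = false).card := by
  classical
  rw [numAv, Nat.card_eq_fintype_card, Fintype.card_subtype]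
  simp only [← occurs_iff, Bool.not_eq_true]

/-- Selecting the 26 involutions of five points before choosing signs, and testing symmetry before
the pattern, keeps the kernel evaluation small. -/
theorem numInvAv_five (p : ColPerm 3) : p.numInvAv 5 =
    (((Finset.univ.filter fun σ : Equiv.Perm (Fin 5) => ∀ i, σ (σ i) = i) ×ˢ Finset.univ).filter
      fun x : ColPerm 5 => (x.2 (x.1 0) == x.2 0 && (x.2 (x.1 1) == x.2 1 &&
        (x.2 (x.1 2) == x.2 2 && (x.2 (x.1 3) == x.2 3 && (x.2 (x.1 4) == x.2 4 &&
        !x.occurs p))))) = true).card := by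
  classical
  rw [numInvAv, Nat.card_eq_fintype_card, Fintype.card_subtype]
  refine congrArg Finset.card (Finset.ext fun x => ?_)
  simp only [Finset.mem_filter, Finset.mem_univ, true_and, Finset.mem_product, and_true, IsInvol,
    ← occurs_iff, Bool.and_eq_true, beq_iff_eq, Bool.not_eq_true', Bool.not_eq_true]
  have hall : ∀ P : Fin 5 → Prop, (∀ i, P i) ↔ P 0 ∧ P 1 ∧ P 2 ∧ P 3 ∧ P 4 := fun P =>
    ⟨fun h => ⟨h 0, h 1, h 2, h 3, h 4⟩, by
      rintro ⟨h0, h1, h2, h3, h4⟩ i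
      fin_cases i <;> assumption⟩
  rw [hall fun i => x.2 (x.1 i) = x.2 i]
  simp only [and_assoc]

set_option maxRecDepth 100000 in
theorem numAv_c123_five : (c123 true true true).numAv 5 = 3312 := by
  rw [numAv_five]
  decide +kernel

set_option maxRecDepth 100000 in
theorem numAv_c132_five : (c132 true false true).numAv 5 = 3311 := by
  rw [numAv_five]
  decide +kernel

/-- Representatives of the classes for signed permutations. -/
def rep : Fin 2 → ColPerm 3 := ![c123 true true true, c132 true false true]

/-- Representatives of the classes for signed involutions. -/
def invRep : Fin 6 → ColPerm 3 :=
  ![c123 true true true, c132 true false true, c231 true true true, c231 false true true,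
    c231 true true false, c321 false true true]

set_option maxRecDepth 100000 in
theorem numInvAv_invRep_five (i : Fin 6) :
    (invRep i).numInvAv 5 = ![256, 288, 292, 291, 299, 298] i := by
  rw [numInvAv_five]
  revert i
  decide +kernel

end ColPerm

/-! ### Assembling the classes -/

namespace ColPerm

/-- The group of symmetries of signed patterns: reversal, complement, inverse and bar. -/
def symm (g : Bool × Bool × Bool × Bool) (p : ColPerm 3) : ColPerm 3 :=
  let p := if g.1 then p.rev else p
  let p := if g.2.1 then p.compl else p
  let p := if g.2.2.1 then p.inv else p
  if g.2.2.2 then p.bar else p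

/-- The symmetries that preserve involutions: reverse complement, inverse and bar. -/
def invSymm (g : Bool × Bool × Bool) (p : ColPerm 3) : ColPerm 3 :=
  let p := if g.1 then p.rev.compl else p
  let p := if g.2.1 then p.inv else p
  if g.2.2 then p.bar else p

theorem numAv_symm (g : Bool × Bool × Bool × Bool) (p : ColPerm 3) (n : ℕ) :
    (symm g p).numAv n = p.numAv n := by
  obtain ⟨a, b, c, d⟩ := g
  cases a <;> cases b <;> cases c <;> cases d <;>
    simp [symm, numAv_rev, numAv_compl, numAv_inv, numAv_bar]

theorem numInvAv_invSymm (g : Bool × Bool × Bool) (p : ColPerm 3) (n : ℕ) :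
    (invSymm g p).numInvAv n = p.numInvAv n := by
  obtain ⟨a, b, c⟩ := g
  cases a <;> cases b <;> cases c <;>
    simp [invSymm, numInvAv_rev_compl, numInvAv_inv, numInvAv_bar]

/-- The class of a signed word for pattern avoidance in signed permutations. -/
def wordClass (w : Fin 3 → ℤ) : Fin 2 :=
  if w ∈ ([![1, 3, -2], ![1, -3, 2], ![-1, 3, -2], ![-1, -3, 2],
    ![2, -1, 3], ![2, -1, -3], ![-2, 1, 3], ![-2, 1, -3],
    ![2, -3, 1], ![2, -3, -1], ![-2, 3, 1], ![-2, 3, -1],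
    ![3, 1, -2], ![3, -1, 2], ![-3, 1, -2], ![-3, -1, 2]] : List (Fin 3 → ℤ)) then 1 else 0

/-- The class of a signed word for pattern avoidance in signed involutions. -/
def invWordClass (w : Fin 3 → ℤ) : Fin 6 :=
  if w ∈ ([![1, 3, -2], ![1, -3, 2], ![-1, 3, -2], ![-1, -3, 2],
    ![2, -1, 3], ![2, -1, -3], ![-2, 1, 3], ![-2, 1, -3]] : List (Fin 3 → ℤ)) then 1
  else if w ∈ ([![2, 3, 1], ![3, 1, 2], ![-2, -3, -1], ![-3, -1, -2]] : List (Fin 3 → ℤ)) then 2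
  else if w ∈ ([![2, -3, 1], ![2, -3, -1], ![-2, 3, 1], ![-2, 3, -1],
    ![3, 1, -2], ![3, -1, 2], ![-3, 1, -2], ![-3, -1, 2]] : List (Fin 3 → ℤ)) then 3
  else if w ∈ ([![2, 3, -1], ![-2, -3, 1], ![3, -1, -2], ![-3, 1, 2]] : List (Fin 3 → ℤ)) then 4
  else if w ∈ ([![3, 2, -1], ![3, -2, -1], ![-3, 2, 1], ![-3, -2, 1]] : List (Fin 3 → ℤ)) then 5
  else 0

/-- A finite check moves each of the 48 patterns by a symmetry into a short list, whose members the
sign flips and `numAv_c123_eq_c132` link to the representative. -/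
theorem numAv_eq_rep (p : ColPerm 3) (n : ℕ) :
    p.numAv n = (rep (wordClass p.toSigned.word)).numAv n := by
  have h : ∀ p : ColPerm 3, ∃ g, symm g p ∈ (![[c123 true true true, c123 false true true,
      c123 true false true, c132 true true true, c132 false true true], [c132 true false true]] :
      Fin 2 → List (ColPerm 3)) (wordClass p.toSigned.word) := by decide +kernel
  obtain ⟨g, hg⟩ := h p
  rw [← numAv_symm g p n]
  revert hg
  generalize wordClass p.toSigned.word = c
  generalize symm g p = q
  intro hg
  fin_cases c <;> simp at hg
  · rcases hg with rfl | rfl | rfl | rfl | rfl <;> simp [rep,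
      ← (flip_c123_first n).1, ← (flip_c123_middle n).1, ← (flip_c132_first n).1,
      numAv_c123_eq_c132]
  · simp [hg, rep]

theorem numInvAv_eq_invRep (p : ColPerm 3) (n : ℕ) :
    p.numInvAv n = (invRep (invWordClass p.toSigned.word)).numInvAv n := by
  have h : ∀ p : ColPerm 3, ∃ g, invSymm g p ∈ (![[c123 true true true, c123 false true true,
      c123 true false true, c132 true true true, c132 false true true, c321 true true true,
      c321 true false true], [c132 true false true], [c231 true true true], [c231 false true true],
      [c231 true true false], [c321 false true true]] :
      Fin 6 → List (ColPerm 3)) (invWordClass p.toSigned.word) := by decide +kernel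
  obtain ⟨g, hg⟩ := h p
  rw [← numInvAv_invSymm g p n]
  revert hg
  generalize invWordClass p.toSigned.word = c
  generalize invSymm g p = q
  intro hg
  fin_cases c <;> simp at hg
  · rcases hg with rfl | rfl | rfl | rfl | rfl | rfl | rfl <;> simp [invRep,
      ← (flip_c123_first n).2, ← (flip_c123_middle n).2, ← (flip_c132_first n).2,
      ← (flip_c321_middle n).2, numInvAv_c321_eq_c132, numInvAv_c123_eq_c132]
  all_goals simp [hg, invRep]

theorem wordClass_rep (i : Fin 2) : wordClass (rep i).toSigned.word = i := by
  revert i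
  decide +kernel

theorem invWordClass_invRep (i : Fin 6) : invWordClass (invRep i).toSigned.word = i := by
  revert i
  decide +kernel

end ColPerm

namespace SignedPerm

/-- Equal classes share a representative and hence all counts; different classes are told apart by
the single length five. -/
theorem wilf_iff (σ τ : SignedPerm 3) :
    wilf 3 σ τ ↔ ColPerm.wordClass σ.word = ColPerm.wordClass τ.word := by
  obtain ⟨p, rfl⟩ := ColPerm.toSigned_surjective σ
  obtain ⟨q, rfl⟩ := ColPerm.toSigned_surjective τ
  have inj : Function.Injective fun i => (ColPerm.rep i).numAv 5 := by
    have : (fun i => (ColPerm.rep i).numAv 5) = ![3312, 3311] := by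
      funext i
      fin_cases i
      · exact ColPerm.numAv_c123_five
      · exact ColPerm.numAv_c132_five
    rw [this]
    decide
  have key : ∀ n, p.toSigned.numAvoiders n = q.toSigned.numAvoiders n ↔
      (ColPerm.rep (ColPerm.wordClass p.toSigned.word)).numAv n =
        (ColPerm.rep (ColPerm.wordClass q.toSigned.word)).numAv n := fun n => by
    rw [ColPerm.numAvoiders_toSigned, ColPerm.numAvoiders_toSigned, ColPerm.numAv_eq_rep p,
      ColPerm.numAv_eq_rep q]
  exact ⟨fun h => inj ((key 5).1 (h 5 (by norm_num))), fun h n _ => (key n).2 (by rw [h])⟩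

theorem wilfInv_iff (σ τ : SignedPerm 3) :
    wilfInv 3 σ τ ↔ ColPerm.invWordClass σ.word = ColPerm.invWordClass τ.word := by
  obtain ⟨p, rfl⟩ := ColPerm.toSigned_surjective σ
  obtain ⟨q, rfl⟩ := ColPerm.toSigned_surjective τ
  have inj : Function.Injective fun i => (ColPerm.invRep i).numInvAv 5 := by
    simp only [ColPerm.numInvAv_invRep_five]
    decide
  have key : ∀ n, p.toSigned.numInvAvoiders n = q.toSigned.numInvAvoiders n ↔
      (ColPerm.invRep (ColPerm.invWordClass p.toSigned.word)).numInvAv n =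
        (ColPerm.invRep (ColPerm.invWordClass q.toSigned.word)).numInvAv n := fun n => by
    rw [ColPerm.numInvAvoiders_toSigned, ColPerm.numInvAvoiders_toSigned,
      ColPerm.numInvAv_eq_invRep p, ColPerm.numInvAv_eq_invRep q]
  exact ⟨fun h => inj ((key 5).1 (h 5 (by norm_num))), fun h n _ => (key n).2 (by rw [h])⟩

end SignedPerm

/-- A setoid that is the kernel of a map with a section: its number of classes and its system of
representatives. -/
theorem Setoid.card_quotient_and_representatives {X : Type*} {m : ℕ} (S : Setoid X) (c : X → Fin m)
    (r : Fin m → X) (hS : ∀ x y, S x y ↔ c x = c y) (hr : ∀ i, c (r i) = i) :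
    Nat.card (Quotient S) = m ∧ ∀ x, ∃! y, y ∈ Set.range r ∧ S x y := by
  constructor
  · have e : Quotient S ≃ Fin m :=
      { toFun := Quotient.lift c fun x y h => (hS x y).1 h
        invFun := fun i => Quotient.mk S (r i)
        left_inv := fun q => Quotient.inductionOn q fun x =>
          Quotient.sound ((hS _ _).2 (hr (c x)))
        right_inv := hr }
    rw [Nat.card_congr e, Nat.card_fin]
  · intro x
    refine ⟨r (c x), ⟨⟨_, rfl⟩, (hS _ _).2 (hr _).symm⟩, ?_⟩
    rintro _ ⟨⟨i, rfl⟩, h⟩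
    rw [(hS _ _).1 h, hr]

namespace ColPerm

theorem toSigned_rep : (fun i => (rep i).toSigned) = ![SignedPerm.p123, SignedPerm.p1b32] := by
  funext i
  apply SignedPerm.ext
  revert i
  decide +kernel

theorem toSigned_invRep : (fun i => (invRep i).toSigned) =
    ![SignedPerm.p123, SignedPerm.p1b32, SignedPerm.p231, SignedPerm.pb231, SignedPerm.p23b1,
      SignedPerm.pb321] := by
  funext i
  apply SignedPerm.ext
  revert i
  decide +kernel

end ColPerm

open SignedPerm in
theorem mainTheorem5 :
    -- avoidance by all signed permutations: exactly two classes, with their representatives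
    (Nat.card (Quotient (wilf 3)) = 2 ∧
      (∀ τ : SignedPerm 3, ∃! ρ : SignedPerm 3,
        ρ ∈ ({p123, p1b32} : Set (SignedPerm 3)) ∧ wilf 3 τ ρ) ∧
      -- the classes explicitly; all 32 remaining patterns are equivalent to 123
      (∀ τ : SignedPerm 3, wilf 3 τ p1b32 ↔ τ.word ∈ ({
        ![1, 3, -2], ![1, -3, 2], ![-1, 3, -2], ![-1, -3, 2],
        ![2, -1, 3], ![2, -1, -3], ![-2, 1, 3], ![-2, 1, -3],
        ![2, -3, 1], ![2, -3, -1], ![-2, 3, 1], ![-2, 3, -1],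
        ![3, 1, -2], ![3, -1, 2], ![-3, 1, -2], ![-3, -1, 2]} : Set (Fin 3 → ℤ)))) ∧
    -- avoidance by signed involutions: exactly six classes, with their representatives
    (Nat.card (Quotient (wilfInv 3)) = 6 ∧
      (∀ τ : SignedPerm 3, ∃! ρ : SignedPerm 3,
        ρ ∈ ({p123, p1b32, p231, pb231, p23b1, pb321} : Set (SignedPerm 3)) ∧
          wilfInv 3 τ ρ) ∧
      -- the classes explicitly; all 20 remaining patterns are equivalent to 123
      (∀ τ : SignedPerm 3,
        (wilfInv 3 τ p1b32 ↔ τ.word ∈ ({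
          ![1, 3, -2], ![1, -3, 2], ![-1, 3, -2], ![-1, -3, 2],
          ![2, -1, 3], ![2, -1, -3], ![-2, 1, 3], ![-2, 1, -3]} : Set (Fin 3 → ℤ))) ∧
        (wilfInv 3 τ p231 ↔ τ.word ∈ ({
          ![2, 3, 1], ![3, 1, 2], ![-2, -3, -1], ![-3, -1, -2]} : Set (Fin 3 → ℤ))) ∧
        (wilfInv 3 τ pb231 ↔ τ.word ∈ ({
          ![2, -3, 1], ![2, -3, -1], ![-2, 3, 1], ![-2, 3, -1],
          ![3, 1, -2], ![3, -1, 2], ![-3, 1, -2], ![-3, -1, 2]} : Set (Fin 3 → ℤ))) ∧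
        (wilfInv 3 τ p23b1 ↔ τ.word ∈ ({
          ![2, 3, -1], ![-2, -3, 1], ![3, -1, -2], ![-3, 1, 2]} : Set (Fin 3 → ℤ))) ∧
        (wilfInv 3 τ pb321 ↔ τ.word ∈ ({
          ![3, 2, -1], ![3, -2, -1], ![-3, 2, 1], ![-3, -2, 1]} : Set (Fin 3 → ℤ))))) := by
  obtain ⟨h1, h2⟩ := Setoid.card_quotient_and_representatives (wilf 3)
    (fun τ => ColPerm.wordClass τ.word) _ wilf_iff ColPerm.wordClass_rep
  obtain ⟨h3, h4⟩ := Setoid.card_quotient_and_representatives (wilfInv 3)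
    (fun τ => ColPerm.invWordClass τ.word) _ wilfInv_iff ColPerm.invWordClass_invRep
  rw [ColPerm.toSigned_rep] at h2
  rw [ColPerm.toSigned_invRep] at h4
  simp only [Matrix.range_cons, Matrix.range_empty, Set.union_empty, Set.singleton_union] at h2 h4
  refine ⟨⟨h1, h2, fun τ => ?_⟩, h3, h4, fun τ => ?_⟩
  -- Replacing the pattern by a coloured permutation makes the quantifier range over an enumerated
  -- finite type, so comparing the list with `wordClass` is a kernel check.
  · obtain ⟨p, rfl⟩ := ColPerm.toSigned_surjective τ
    simp only [wilf_iff, Set.mem_insert_iff, Set.mem_singleton_iff]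
    revert p
    decide +kernel
  · obtain ⟨p, rfl⟩ := ColPerm.toSigned_surjective τ
    simp only [wilfInv_iff, Set.mem_insert_iff, Set.mem_singleton_iff]
    refine ⟨?_, ?_, ?_, ?_, ?_⟩ <;> revert p <;> decide +kernel
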